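/- **Directed Jumping Arc Lemma.** *Definitions.* Let $D=(V,E)$ be a digraph (of any cardinality, without loops and parallel edges). *Ends.* For a finite set $X\subseteq V$, the strong components of $D-X$ are its maximal strongly connected subdigraphs. $D$ is *solid* if $D-X$ has only finitely many strong components for every finite $X\subseteq V$. A directed ray (one-way infinite directed path with a first vertex) is *solid in $D$* if for every finite $X\subseteq V$ it has a tail in some strong component of $D-X$; two solid rays are equivalent if for every finite $X$ they have a tail in the same strong component of $D-X$. The equivalence classes are the *ends* of $D$; $C(X,\omega)$ denotes the strong component of $D-X$ in which the rays of the end $\omega$ have a tail, and $\omega$ is said to *live* in $C(X,\omega)$. *Limit edges.* For distinct ends $\omega,\eta$ the pair $\omega\eta$ is a *limit edge* if $D$ has an edge from $C(X,\omega)$ to $C(X,\eta)$ for every finite $X$ with $C(X,\omega)\ne C(X,\eta)$. For a vertex $v$ and an end $\omega$, the pair $v\omega$ (respectively $\omega v$) is a *limit edge* if $D$ has an edge from $v$ to $C(X,\omega)$ (respectively from $C(X,\omega)$ to $v$) for every finite $X$ with $v\notin C(X,\omega)$. Let $\Lambda$ be the set of limit edges. *The space $|D|$.* Its ground set consists of the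 vertices and the ends of $D$ together with a copy $[0,1]_e$ of the unit interval for every $e\in E\cup\Lambda$, where $0$ is identified with the tail and $1$ with the head of $e$; the image of $[0,1]_e$ is an *edge of $|D|$*. Its topology is generated by the following sets, for all $\varepsilon>0$ (balls on edges always consist of inner points only): - for each vertex $v$, the uniform star of radius $\varepsilon$ around $v$: $v$ together with all inner points at distance less than $\varepsilon$ from $v$ on edges in $E\cup\Lambda$ incident with $v$; - for each inner point of an edge in $E$, the ball of radius $\varepsilon$ around it on this edge; - for each end $\omega$ and finite $X$, the set consisting of all vertices in and ends living in $C(X,\omega)$, all inner points of edges in $E\cup\Lambda$ with both endvertices in or living in $C(X,\omega)$, and, on every edge in $E\cup\Lambda$ with an endpoint in or living in $C(X,\omega)$, all inner points at distance less than $\varepsilon$ from that endpoint; - for each inner point $z\in(0,1)$ of a limit edge $\omega\eta$ between ends and each finite $X$ with $C(X,\omega)\neq C(X,\eta)$, the union of the balls of radius $\varepsilon$ around the points corresponding to $z$ on all edges in $E\cup\Lambda$ whose tail is in or lives in $C(X,\omega)$ and whose head is in or lives in $C(X,\eta)$; likewise for each inner point of a limit edge $v\omega$ (respectively $\omega v$)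 and each finite $X\ni v$, with tail $v$ and head in or living in $C(X,\omega)$ (respectively tail in or living in $C(X,\omega)$ and head $v$). *Directed topological paths.* A *directed topological path* in $|D|$ is a continuous map $\alpha\colon[0,1]\to|D|$ such that (a) every $x\in(0,1)$ that is mapped to an inner point of an edge $e$ of $|D|$ has a neighbourhood $(a,b)$ such that $\alpha$ restricts on $(a,b)$ to a homeomorphism onto the interior of $e$; and (b) whenever $\alpha$ maps $[a,b]\subseteq[0,1]$ into an edge $e$, then $\alpha(x)\le\alpha(y)$ in $[0,1]_e$ for all $x\le y$ in $[a,b]$. It is a path *from $V_1$ to $V_2$* if $\alpha(0)\in V_1$ and $\alpha(1)\in V_2$. It *traverses* the edge $e$ if it restricts on a subinterval of $[0,1]$ to a homeomorphism onto $e$. Closures are taken in $|D|$. *Statement.* Let $D$ be any digraph and let $\{V_1,V_2\}$ be a bipartition of $V(D)$, i.e. $V_1\cup V_2=V(D)$ and $V_1\cap V_2=\emptyset$. 1. If $\overline{V_1}\cap\overline{V_2}=\emptyset$, then every directed topological path in $|D|$ from $V_1$ to $V_2$ traverses an edge of $|D|$ with tail in $\overline{V_1}$ and head in $\overline{V_2}$.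 2. If $\overline{V_1}\cap\overline{V_2}\neq\emptyset$ and both $D[V_1]$ and $D[V_2]$ are solid, then there is a directed topological path in $|D|$ from $V_1$ to $V_2$ that traverses no edge of $|D|$ between $\overline{V_1}$ and $\overline{V_2}$, i.e. no edge that has its tail in one of these two sets and its head in the other. -/

import Mathlib

namespace DTop

universe u

section Combinatorics

variable {V : Type u}

/-- The induced subdigraph `D[A]`. -/
def induce (D : Digraph V) (A : Set V) : Digraph A where
  Adj a b := D.Adj a b

/-- `w` can be reached from `v` in `D - X` (both vertices lie outside `X`). -/
def Reach (D : Digraph V) (X : Finset V) (v w : V) : Prop :=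
  v ∉ X ∧ w ∉ X ∧ Relation.ReflTransGen (fun a b => D.Adj a b ∧ a ∉ X ∧ b ∉ X) v w

/-- The vertex set of the strong component of `D - X` that contains `v`
(it is empty if `v ∈ X`). -/
def strongComp (D : Digraph V) (X : Finset V) (v : V) : Set V :=
  {w | Reach D X v w ∧ Reach D X w v}

/-- `C` is the vertex set of a strong component of `D - X`. -/
def IsStrongComp (D : Digraph V) (X : Finset V) (C : Set V) : Prop :=
  ∃ v, v ∉ X ∧ C = strongComp D X v

/-- `D` is solid: `D - X` has only finitely many strong components for every finite `X`. -/
def IsSolid (D : Digraph V) : Prop :=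
  ∀ X : Finset V, {C : Set V | IsStrongComp D X C}.Finite

/-- The vertex sequence of a directed ray. -/
def IsRay (D : Digraph V) (r : ℕ → V) : Prop :=
  Function.Injective r ∧ ∀ n, D.Adj (r n) (r (n + 1))

/-- The ray `r` has a tail in `C`. -/
def HasTailIn (r : ℕ → V) (C : Set V) : Prop :=
  ∃ N, ∀ n, N ≤ n → r n ∈ C

/-- The ray `r` is solid in `D`. -/
def IsSolidRay (D : Digraph V) (r : ℕ → V) : Prop :=
  IsRay D r ∧ ∀ X : Finset V, ∃ C, IsStrongComp D X C ∧ HasTailIn r C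

theorem Reach.trans {D : Digraph V} {X : Finset V} {a b c : V}
    (h : Reach D X a b) (h' : Reach D X b c) : Reach D X a c :=
  ⟨h.1, h'.2.1, h.2.2.trans h'.2.2⟩

theorem strongComp_eq {D : Digraph V} {X : Finset V} {v w : V}
    (h : w ∈ strongComp D X v) : strongComp D X w = strongComp D X v := by
  ext x
  exact ⟨fun hx => ⟨h.1.trans hx.1, hx.2.trans h.2⟩, fun hx => ⟨h.2.trans hx.1, hx.2.trans h.1⟩⟩

theorem IsStrongComp.eq_of_mem {D : Digraph V} {X : Finset V} {C C' : Set V} {w : V}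
    (h : IsStrongComp D X C) (h' : IsStrongComp D X C') (hw : w ∈ C) (hw' : w ∈ C') : C = C' := by
  obtain ⟨v, -, rfl⟩ := h
  obtain ⟨v', -, rfl⟩ := h'
  rw [← strongComp_eq hw, strongComp_eq hw']

theorem IsStrongComp.eq_of_tail {D : Digraph V} {X : Finset V} {C C' : Set V} {r : ℕ → V}
    (h : IsStrongComp D X C) (h' : IsStrongComp D X C') (hr : HasTailIn r C)
    (hr' : HasTailIn r C') : C = C' := by
  obtain ⟨N, hN⟩ := hr
  obtain ⟨M, hM⟩ := hr'
  exact h.eq_of_mem h' (hN (max N M) (le_max_left _ _)) (hM (max N M) (le_max_right _ _))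

/-- Two solid rays are equivalent if, for every finite `X`, they have a tail in the same strong
component of `D - X`. -/
def raySetoid (D : Digraph V) : Setoid {r : ℕ → V // IsSolidRay D r} where
  r a b := ∀ X : Finset V, ∃ C, IsStrongComp D X C ∧ HasTailIn a.1 C ∧ HasTailIn b.1 C
  iseqv :=
    { refl := fun a X => by
        obtain ⟨C, hC, h⟩ := a.2.2 X
        exact ⟨C, hC, h, h⟩
      symm := fun h X => by
        obtain ⟨C, hC, h₁, h₂⟩ := h X
        exact ⟨C, hC, h₂, h₁⟩
      trans := fun h h' X => by
        obtain ⟨C, hC, h₁, h₂⟩ := h X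
        obtain ⟨C', hC', h₁', h₂'⟩ := h' X
        obtain rfl := hC.eq_of_tail hC' h₂ h₁'
        exact ⟨C, hC, h₁, h₂'⟩ }

/-- The set `Ω(D)` of ends of `D`. -/
def DEnd (D : Digraph V) : Type u := Quotient (raySetoid D)

/-- The vertex set of the strong component `C(X, ω)` of `D - X` in which the end `ω` lives, i.e.
in which one (equivalently, every) ray representing `ω` has a tail. -/
def endComp (D : Digraph V) (X : Finset V) (ω : DEnd D) : Set V :=
  Quotient.lift
    (fun r : {r : ℕ → V // IsSolidRay D r} => {v | HasTailIn r.1 (strongComp D X v)})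
    (by
      intro a b hab
      obtain ⟨C, hC, ha, hb⟩ := hab X
      have key : ∀ (r : ℕ → V), HasTailIn r C → ∀ v, HasTailIn r (strongComp D X v) →
          strongComp D X v = C := by
        intro r hr v hv
        obtain ⟨N, hN⟩ := hv
        have hvX : v ∉ X := (hN N le_rfl).1.1
        exact IsStrongComp.eq_of_tail ⟨v, hvX, rfl⟩ hC ⟨N, hN⟩ hr
      ext v
      constructor
      · intro hv
        have e := key a.1 ha v hv
        simpa only [Set.mem_ofPred_eq, e] using hb
      · intro hv
        have e := key b.1 hb v hv
        simpa only [Set.mem_ofPred_eq, e] using ha)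
    ω

/-- The vertices and ends of `D`. -/
inductive Node (D : Digraph V) : Type u
  | vtx (v : V) : Node D
  | lim (ω : DEnd D) : Node D

/-- There is an edge or a limit edge of `D` with the given tail and head. -/
def IsEdge (D : Digraph V) : Node D → Node D → Prop
  | .vtx v, .vtx w => D.Adj v w
  | .vtx v, .lim ω => ∀ X : Finset V, v ∉ endComp D X ω → ∃ w ∈ endComp D X ω, D.Adj v w
  | .lim ω, .vtx v => ∀ X : Finset V, v ∉ endComp D X ω → ∃ u ∈ endComp D X ω, D.Adj u v
  | .lim ω, .lim η => ω ≠ η ∧ ∀ X : Finset V, endComp D X ω ≠ endComp D X η →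
      ∃ u ∈ endComp D X ω, ∃ w ∈ endComp D X η, D.Adj u w

/-- The elements of `E ∪ Λ`: the edges and the limit edges of `D`. -/
structure Edge (D : Digraph V) : Type u where
  tail : Node D
  head : Node D
  isEdge : IsEdge D tail head

/-- The ground set of `|D|`: vertices, ends and, for each edge or limit edge `e`, the inner points
of a copy of the unit interval (`0` is identified with the tail and `1` with the head of `e`, see
`edgePt`). -/
inductive Space (D : Digraph V) : Type u
  | node (x : Node D) : Space D
  | inner (e : Edge D) (t : Set.Ioo (0 : ℝ) 1) : Space D

open Classical in
/-- The point of `|D|` that corresponds to the point `t` of the copy `[0,1]_e`. -/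
noncomputable def edgePt {D : Digraph V} (e : Edge D) (t : unitInterval) : Space D :=
  if h : 0 < (t : ℝ) ∧ (t : ℝ) < 1 then .inner e ⟨t, h⟩
  else if (t : ℝ) = 0 then .node e.tail else .node e.head

/-- The edge of `|D|` that is obtained from `[0,1]_e`. -/
def closedEdge {D : Digraph V} (e : Edge D) : Set (Space D) :=
  Set.range (edgePt e)

/-- The interior of the edge `e` of `|D|`: the set of its inner points. -/
def openEdge {D : Digraph V} (e : Edge D) : Set (Space D) :=
  Set.range (Space.inner e)

/-- `A ⊆ V(D)`, seen as a set of points of `|D|`. -/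
def vertexSet (D : Digraph V) (A : Set V) : Set (Space D) :=
  (fun v => Space.node (Node.vtx v)) '' A

/-- The vertex or end `x` is contained in, respectively lives in, the vertex set `C`, where `C` is
a strong component of `D - X` (or consists of a single vertex in `X`, in which
case no end lives in it). -/
def InComp (D : Digraph V) (X : Finset V) (C : Set V) : Node D → Prop
  | .vtx v => v ∈ C
  | .lim ω => endComp D X ω = C

/-- The edge `e` belongs to, or the limit edge `e` lives in, the bundle `E(A, B)`, where `A` and
`B` are distinct and each of them is a strong component of `D - X` or consists of a single vertex
in `X`. -/
def InBundle {D : Digraph V} (X : Finset V) (A B : Set V) (e : Edge D) : Prop :=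
  InComp D X A e.tail ∧ InComp D X B e.head

/-- The uniform star of radius `ε` around the vertex `v`. -/
def star (D : Digraph V) (v : V) (ε : ℝ) : Set (Space D) :=
  {p | match p with
    | .node x => x = .vtx v
    | .inner e t => (e.tail = .vtx v ∧ (t : ℝ) < ε) ∨ (e.head = .vtx v ∧ 1 - ε < (t : ℝ))}

/-- The open ball of radius `ε` around the point `z` of the edge `e` (inner points only). -/
def edgeBall {D : Digraph V} (e : Edge D) (z ε : ℝ) : Set (Space D) :=
  {p | ∃ t : Set.Ioo (0 : ℝ) 1, |(t : ℝ) - z| < ε ∧ p = .inner e t}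

/-- The set `Ĉ_ε(X, ω)`: all vertices, ends, edges and limit edges in `C(X, ω)`, together with
the half-open partial edges of length `ε` at the endpoints that are contained or live in
`C(X, ω)`. -/
def endNhd (D : Digraph V) (X : Finset V) (ω : DEnd D) (ε : ℝ) : Set (Space D) :=
  {p | match p with
    | .node x => InComp D X (endComp D X ω) x
    | .inner e t =>
        (InComp D X (endComp D X ω) e.tail ∧ InComp D X (endComp D X ω) e.head) ∨
        (InComp D X (endComp D X ω) e.tail ∧ (t : ℝ) < ε) ∨
        (InComp D X (endComp D X ω) e.head ∧ 1 - ε < (t : ℝ))}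

/-- The union of the open balls of radius `ε` around the points corresponding to `z` on the edges
and limit edges of the bundle `E(A, B)`. -/
def bundleNhd (D : Digraph V) (X : Finset V) (A B : Set V) (z ε : ℝ) : Set (Space D) :=
  ⋃ (e : Edge D) (_ : InBundle X A B e), edgeBall e z ε

/-- The basic open sets of `|D|`. -/
inductive IsBasicOpen (D : Digraph V) : Set (Space D) → Prop
  | vertex (v : V) (ε : ℝ) (hε : 0 < ε) : IsBasicOpen D (star D v ε)
  | edge (e : Edge D) (v w : V) (hv : e.tail = .vtx v) (hw : e.head = .vtx w)
      (z : Set.Ioo (0 : ℝ) 1) (ε : ℝ) (hε : 0 < ε) : IsBasicOpen D (edgeBall e z ε)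
  | endPoint (X : Finset V) (ω : DEnd D) (ε : ℝ) (hε : 0 < ε) : IsBasicOpen D (endNhd D X ω ε)
  | endEnd (e : Edge D) (ω η : DEnd D) (hω : e.tail = .lim ω) (hη : e.head = .lim η)
      (X : Finset V) (hX : endComp D X ω ≠ endComp D X η)
      (z : Set.Ioo (0 : ℝ) 1) (ε : ℝ) (hε : 0 < ε) :
      IsBasicOpen D (bundleNhd D X (endComp D X ω) (endComp D X η) z ε)
  | vertexEnd (e : Edge D) (v : V) (ω : DEnd D) (hv : e.tail = .vtx v) (hω : e.head = .lim ω)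
      (X : Finset V) (hX : v ∈ X)
      (z : Set.Ioo (0 : ℝ) 1) (ε : ℝ) (hε : 0 < ε) :
      IsBasicOpen D (bundleNhd D X {v} (endComp D X ω) z ε)
  | endVertex (e : Edge D) (v : V) (ω : DEnd D) (hω : e.tail = .lim ω) (hv : e.head = .vtx v)
      (X : Finset V) (hX : v ∈ X)
      (z : Set.Ioo (0 : ℝ) 1) (ε : ℝ) (hε : 0 < ε) :
      IsBasicOpen D (bundleNhd D X (endComp D X ω) {v} z ε)

/-- The topology of `|D|`. -/
instance instTopologicalSpaceSpace (D : Digraph V) : TopologicalSpace (Space D) :=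
  TopologicalSpace.generateFrom {U | IsBasicOpen D U}

/-- Every `x ∈ (0,1)` that is mapped to an inner point of an edge `e` of `|D|` has a neighbourhood
`(a, b)` that is mapped homeomorphically onto the interior of `e`. -/
def IsLocalHomeoOnEdges {D : Digraph V} (α : C(unitInterval, Space D)) : Prop :=
  ∀ (e : Edge D) (x : unitInterval), x ∈ Set.Ioo 0 1 → α x ∈ openEdge e →
    ∃ a b : unitInterval, x ∈ Set.Ioo a b ∧
      ∃ h : Set.Ioo a b ≃ₜ openEdge e, ∀ t, (h t : Space D) = α t

/-- Whenever `[a, b]` is mapped to an edge `e`, then `x ≤ y` implies `α x ≤ α y` in `[0,1]_e` for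
all `x, y ∈ [a, b]`. -/
def RespectsOrientation {D : Digraph V} (α : C(unitInterval, Space D)) : Prop :=
  ∀ (e : Edge D) (a b : unitInterval), Set.MapsTo α (Set.Icc a b) (closedEdge e) →
    ∀ x ∈ Set.Icc a b, ∀ y ∈ Set.Icc a b, x ≤ y →
      ∀ s t : unitInterval, α x = edgePt e s → α y = edgePt e t → s ≤ t

/-- A directed topological path in `|D|`. -/
def IsDirectedTopPath {D : Digraph V} (α : C(unitInterval, Space D)) : Prop :=
  IsLocalHomeoOnEdges α ∧ RespectsOrientation α

/-- `α` traverses the edge `e` of `|D|`: it restricts on a subinterval of `[0,1]` to a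
homeomorphism onto `e`. -/
def Traverses {D : Digraph V} (α : C(unitInterval, Space D)) (e : Edge D) : Prop :=
  ∃ a b : unitInterval, a ≤ b ∧
    ∃ h : Set.Icc a b ≃ₜ closedEdge e, ∀ t, (h t : Space D) = α t

/-- `e` is an edge of `|D|` with tail in `S` and head in `T`. -/
def EdgeFromTo {D : Digraph V} (S T : Set (Space D)) (e : Edge D) : Prop :=
  Space.node e.tail ∈ S ∧ Space.node e.head ∈ T

end Combinatorics

end DTop

namespace DTop

universe u

section Directions

open Relation

variable {V : Type u}

theorem reflTransGen_imp {r s : V → V → Prop} {a b : V} (h : ReflTransGen r a b)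
    (hrs : ∀ a b, r a b → s a b) : ReflTransGen s a b := by
  induction h with
  | refl => exact .refl
  | tail _ h ih => exact ih.tail (hrs _ _ h)

/-- The digraph obtained by reversing all edges. -/
def reverse (D : Digraph V) : Digraph V where
  Adj a b := D.Adj b a

theorem reach_reverse {D : Digraph V} {X : Finset V} {a b : V} :
    Reach (reverse D) X a b ↔ Reach D X b a := by
  have key : ∀ (E : Digraph V) (a b : V), Reach (reverse E) X a b → Reach E X b a := by
    rintro E a b ⟨ha, hb, h⟩
    exact ⟨hb, ha, reflTransGen_imp h.swap fun _ _ h => ⟨h.1, h.2.2, h.2.1⟩⟩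
  exact ⟨key D a b, key (reverse D) b a⟩

theorem IsStrongComp.reverse {D : Digraph V} {X : Finset V} {C : Set V}
    (h : IsStrongComp D X C) : IsStrongComp (reverse D) X C := by
  obtain ⟨v, hv, rfl⟩ := h
  refine ⟨v, hv, ?_⟩
  ext w
  simp only [strongComp, Set.mem_ofPred_eq, reach_reverse]
  exact and_comm

theorem Reach.refl {D : Digraph V} {X : Finset V} {v : V} (h : v ∉ X) : Reach D X v v :=
  ⟨h, h, .refl⟩

theorem Reach.anti {D : Digraph V} {X Y : Finset V} (hXY : X ⊆ Y) {v w : V}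
    (h : Reach D Y v w) : Reach D X v w :=
  ⟨fun h' => h.1 (hXY h'), fun h' => h.2.1 (hXY h'),
    reflTransGen_imp h.2.2 fun _ _ h => ⟨h.1, fun h' => h.2.1 (hXY h'), fun h' => h.2.2 (hXY h')⟩⟩

theorem Reach.of_transGen {D : Digraph V} {X : Finset V} {C : Set V} (hC : ∀ x ∈ C, x ∉ X)
    {v w : V} (hv : v ∈ C) (h : ReflTransGen (fun a b => D.Adj a b ∧ a ∈ C ∧ b ∈ C) v w) :
    Reach D X v w := by
  refine ⟨hC v hv, ?_, reflTransGen_imp h fun _ _ h => ⟨h.1, hC _ h.2.1, hC _ h.2.2⟩⟩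
  induction h with
  | refl => exact hC v hv
  | tail _ h _ => exact hC _ h.2.2

namespace IsStrongComp

variable {D : Digraph V} {X : Finset V} {C : Set V}

theorem nonempty (h : IsStrongComp D X C) : C.Nonempty := by
  obtain ⟨v, hv, rfl⟩ := h
  exact ⟨v, .refl hv, .refl hv⟩

theorem notMem (h : IsStrongComp D X C) {x : V} (hx : x ∈ C) : x ∉ X := by
  obtain ⟨v, hv, rfl⟩ := h
  exact hx.1.2.1

theorem reach (h : IsStrongComp D X C) {x y : V} (hx : x ∈ C) (hy : y ∈ C) : Reach D X x y := by
  obtain ⟨v, hv, rfl⟩ := h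
  exact hx.2.trans hy.1

theorem mem_of_reach (h : IsStrongComp D X C) {x y z : V} (hx : x ∈ C) (hz : z ∈ C)
    (hxy : Reach D X x y) (hyz : Reach D X y z) : y ∈ C := by
  obtain ⟨v, hv, rfl⟩ := h
  exact ⟨hx.1.trans hxy, hyz.trans hz.2⟩

theorem path (h : IsStrongComp D X C) {x y : V} (hx : x ∈ C) (hy : y ∈ C) :
    ReflTransGen (fun a b => D.Adj a b ∧ a ∈ C ∧ b ∈ C) x y := by
  obtain ⟨hxX, hyX, hp⟩ := h.reach hx hy
  induction hp using ReflTransGen.head_induction_on with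
  | refl => exact .refl
  | @head a b hab hby ih =>
    have hb : b ∈ C := h.mem_of_reach hx hy ⟨hxX, hab.2.2, .single hab⟩ ⟨hab.2.2, hyX, hby⟩
    exact .head ⟨hab.1, hx, hb⟩ (ih hb hab.2.2)

/-- A strongly connected set of vertices that meets a strong component of `D - X` and avoids `X`
is contained in it. -/
theorem subset_of_connected (h : IsStrongComp D X C) {A : Set V} (hA : ∀ x ∈ A, x ∉ X)
    (hconn : ∀ x ∈ A, ∀ y ∈ A, ReflTransGen (fun a b => D.Adj a b ∧ a ∈ A ∧ b ∈ A) x y)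
    {z : V} (hz : z ∈ A) (hzC : z ∈ C) : A ⊆ C := fun x hx =>
  h.mem_of_reach hzC hzC (.of_transGen hA hz (hconn z hz x hx))
    (.of_transGen hA hx (hconn x hx z hz))

end IsStrongComp

theorem exists_finset_path {r : V → V → Prop} {x y : V} (h : ReflTransGen r x y) :
    ∃ P : Finset V, ReflTransGen (fun a b => r a b ∧ a ∈ P ∧ b ∈ P) x y := by
  classical
  induction h with
  | refl => exact ⟨∅, .refl⟩
  | @tail b c _ hbc ih =>
    obtain ⟨P, hP⟩ := ih
    refine ⟨insert b (insert c P), .tail (reflTransGen_imp hP fun _ _ h => ?_) ⟨hbc, by simp, by simp⟩⟩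
    exact ⟨h.1, by simp [h.2.1], by simp [h.2.2]⟩

/-- `f` is a direction of `D`: it chooses, consistently, a strong component of `D - X` for every
finite set `X` of vertices. -/
structure IsDirection (D : Digraph V) (f : Finset V → Set V) : Prop where
  isStrongComp : ∀ X, IsStrongComp D X (f X)
  anti : ∀ ⦃X Y⦄, X ⊆ Y → f Y ⊆ f X

/-- The vertices that, outside every finite set `X`, reach the component chosen by `f`. -/
def reachesDirection (D : Digraph V) (f : Finset V → Set V) : Set V :=
  {x | ∀ X : Finset V, x ∉ X → ∃ y ∈ f X, Reach D X x y}

variable {D : Digraph V} {f : Finset V → Set V}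

theorem IsDirection.reverse (hf : IsDirection D f) : IsDirection (reverse D) f :=
  ⟨fun X => (hf.isStrongComp X).reverse, hf.anti⟩

theorem IsDirection.exists_seq (hf : IsDirection D f) (X₀ : Finset V) (S : V → Finset V)
    (T : Finset V → Finset V) :
    ∃ X : ℕ → Finset V, X 0 = X₀ ∧ Monotone X ∧ (∀ n, T (X n) ⊆ X (n + 1)) ∧
      (∀ n, ∀ x ∈ X n, S x ⊆ X (n + 1)) ∧
      ∀ n, ∀ x ∈ (⋃ k, (X k : Set V)) ∩ f (X n), ∀ y ∈ (⋃ k, (X k : Set V)) ∩ f (X n),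
        ReflTransGen (fun a b => D.Adj a b ∧ a ∈ (⋃ k, (X k : Set V)) ∩ f (X n) ∧
          b ∈ (⋃ k, (X k : Set V)) ∩ f (X n)) x y := by
  classical
  have hP : ∀ (Z : Finset V) (x y : V), ∃ P : Finset V, x ∈ f Z → y ∈ f Z →
      ReflTransGen (fun a b => (D.Adj a b ∧ a ∈ f Z ∧ b ∈ f Z) ∧ a ∈ P ∧ b ∈ P) x y := by
    intro Z x y
    by_cases h : x ∈ f Z ∧ y ∈ f Z
    · obtain ⟨P, hP⟩ := exists_finset_path ((hf.isStrongComp Z).path h.1 h.2)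
      exact ⟨P, fun _ _ => hP⟩
    · exact ⟨∅, fun hx hy => (h ⟨hx, hy⟩).elim⟩
  choose P hP using hP
  set G : Finset V → Finset V := fun X => X ∪ T X ∪ X.biUnion S ∪
    X.powerset.biUnion fun Z => X.biUnion fun x => X.biUnion fun y => P Z x y with hG
  set X : ℕ → Finset V := fun n => G^[n] X₀ with hX
  have hs : ∀ n, X (n + 1) = G (X n) := fun n => Function.iterate_succ_apply' G n X₀
  have hmono : Monotone X := monotone_nat_of_le_succ fun n => by
    rw [hs, hG]
    intro x hx
    simp [hx]
  refine ⟨X, rfl, hmono, fun n x hx => ?_, fun n x hx y hy => ?_, ?_⟩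
  · rw [hs, hG]
    simp [hx]
  · rw [hs, hG]
    simp only [Finset.mem_union, Finset.mem_biUnion]
    exact .inl (.inr ⟨x, hx, hy⟩)
  · rintro n x ⟨hx, hxf⟩ y ⟨hy, hyf⟩
    obtain ⟨a, ha⟩ := Set.mem_iUnion.1 hx
    obtain ⟨b, hb⟩ := Set.mem_iUnion.1 hy
    obtain ⟨m, hn, ha', hb'⟩ : ∃ m, n ≤ m ∧ a ≤ m ∧ b ≤ m :=
      ⟨max n (max a b), by simp, by simp, by simp⟩
    have hsub : P (X n) x y ⊆ X (m + 1) := by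
      intro z hz
      rw [hs, hG]
      simp only [Finset.mem_union, Finset.mem_biUnion, Finset.mem_powerset]
      exact .inr ⟨X n, hmono hn, x, hmono ha' ha, y, hmono hb' hb, hz⟩
    refine reflTransGen_imp (hP (X n) x y hxf hyf) fun c d h => ⟨h.1.1, ⟨?_, h.1.2.1⟩, ?_, h.1.2.2⟩
    · exact Set.mem_iUnion.2 ⟨m + 1, hsub h.2.1⟩
    · exact Set.mem_iUnion.2 ⟨m + 1, hsub h.2.2⟩

/-- An increasing sequence of finite sets that determines the direction `f`. -/
structure IsDeterminingSeq (D : Digraph V) (f : Finset V → Set V) (X : ℕ → Finset V) : Prop where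
  mono : Monotone X
  nonempty : ∀ n, ((X (n + 1) : Set V) ∩ f (X n)).Nonempty
  connected : ∀ n, ∀ x ∈ (⋃ k, (X k : Set V)) ∩ f (X n),
    ∀ y ∈ (⋃ k, (X k : Set V)) ∩ f (X n),
      ReflTransGen (fun a b => D.Adj a b ∧ a ∈ (⋃ k, (X k : Set V)) ∩ f (X n) ∧
        b ∈ (⋃ k, (X k : Set V)) ∩ f (X n)) x y
  cofinal : ∀ Y, ∃ n, (⋃ k, (X k : Set V)) ∩ f (X n) ⊆ f Y

theorem IsDeterminingSeq.reverse {X : ℕ → Finset V} (h : IsDeterminingSeq D f X) :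
    IsDeterminingSeq (reverse D) f X :=
  ⟨h.mono, h.nonempty, fun n x hx y hy =>
    reflTransGen_imp (h.connected n y hy x hx).swap fun _ _ h => ⟨h.1, h.2.2, h.2.1⟩, h.cofinal⟩

theorem exists_finset_inter_iUnion_subset {X : ℕ → Finset V} (hX : Monotone X) (Y : Finset V) :
    ∃ n, ∀ y ∈ Y, y ∈ (⋃ k, (X k : Set V)) → y ∈ X n := by
  classical
  induction Y using Finset.induction_on with
  | empty => exact ⟨0, by simp⟩
  | insert a Y _ ih =>
    obtain ⟨n, hn⟩ := ih
    by_cases ha : a ∈ ⋃ k, (X k : Set V)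
    · obtain ⟨m, hm⟩ := Set.mem_iUnion.1 ha
      refine ⟨max n m, fun y hy hyX => ?_⟩
      obtain rfl | hy := Finset.mem_insert.1 hy
      · exact hX (le_max_right _ _) hm
      · exact hX (le_max_left _ _) (hn y hy hyX)
    · refine ⟨n, fun y hy hyX => ?_⟩
      obtain rfl | hy := Finset.mem_insert.1 hy
      · exact (ha hyX).elim
      · exact hn y hy hyX

theorem IsDirection.exists_determiningSeq_of_meets (hf : IsDirection D f)
    (hA : ∀ X, (reachesDirection D f ∩ f X).Nonempty)
    (hB : ∀ X, (reachesDirection (DTop.reverse D) f ∩ f X).Nonempty) :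
    ∃ X, IsDeterminingSeq D f X := by
  classical
  choose a haA haf using hA
  choose b hbB hbf using hB
  obtain ⟨X, -, hmono, hT, -, hconn⟩ := hf.exists_seq ∅ (fun _ => ∅) fun X => {a X, b X}
  have ha : ∀ n, a (X n) ∈ X (n + 1) := fun n => hT n (by simp)
  have hb : ∀ n, b (X n) ∈ X (n + 1) := fun n => hT n (by simp)
  refine ⟨X, hmono, fun n => ⟨_, ha n, haf _⟩, hconn, fun Y => ?_⟩
  obtain ⟨n, hn⟩ := exists_finset_inter_iUnion_subset hmono Y
  have hY : ∀ x ∈ (⋃ k, (X k : Set V)) ∩ f (X n), x ∉ Y := fun x hx hxY =>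
    (hf.isStrongComp _).notMem hx.2 (hn x hxY hx.1)
  have ha' : a (X n) ∈ (⋃ k, (X k : Set V)) ∩ f (X n) :=
    ⟨Set.mem_iUnion.2 ⟨n + 1, ha n⟩, haf _⟩
  have hb' : b (X n) ∈ (⋃ k, (X k : Set V)) ∩ f (X n) :=
    ⟨Set.mem_iUnion.2 ⟨n + 1, hb n⟩, hbf _⟩
  obtain ⟨c, hc, hac⟩ := haA (X n) Y (hY _ ha')
  obtain ⟨d, hd, hbd⟩ := hbB (X n) Y (hY _ hb')
  rw [reach_reverse] at hbd
  refine ⟨n, fun x hx => (hf.isStrongComp Y).mem_of_reach hd hc ?_ ?_⟩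
  · exact hbd.trans (.of_transGen hY hb' (hconn n _ hb' x hx))
  · exact .trans (.of_transGen hY hx (hconn n x hx _ ha')) hac

theorem IsDirection.exists_determiningSeq_of_disjoint (hf : IsDirection D f) (X₀ : Finset V)
    (hA : ∀ x ∈ f X₀, x ∉ reachesDirection D f) : ∃ X, IsDeterminingSeq D f X := by
  classical
  have hS : ∀ x, ∃ S : Finset V, x ∈ f X₀ → x ∉ S ∧ ∀ y ∈ f S, ¬ Reach D S x y := by
    intro x
    by_cases hx : x ∈ f X₀
    · have := hA x hx
      simp only [reachesDirection, Set.mem_ofPred_eq, not_forall] at this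
      obtain ⟨S, hxS, hS⟩ := this
      exact ⟨S, fun _ => ⟨hxS, fun y hy h => hS ⟨y, hy, h⟩⟩⟩
    · exact ⟨∅, fun h => (hx h).elim⟩
  choose S hS using hS
  choose t ht using fun X => (hf.isStrongComp X).nonempty
  obtain ⟨X, hX0, hmono, hT, hSX, hconn⟩ := hf.exists_seq X₀ S fun X => {t X}
  have ht' : ∀ n, t (X n) ∈ X (n + 1) := fun n => hT n (by simp)
  have hempty : ∀ y, ∃ n, y ∉ f (X n) := by
    intro y
    by_contra! hy
    have hyX : y ∉ ⋃ k, (X k : Set V) := fun h => by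
      obtain ⟨k, hk⟩ := Set.mem_iUnion.1 h
      exact (hf.isStrongComp _).notMem (hy k) hk
    have claim : ∀ x, ReflTransGen (fun a b => D.Adj a b ∧ a ∈ f (X 0) ∧ b ∈ f (X 0)) x y →
        (∃ x' ∈ (⋃ k, (X k : Set V)) ∩ f (X 0), ∀ Z : Finset V, (Z : Set V) ⊆ (⋃ k, (X k : Set V)) →
          x' ∉ Z → Reach D Z x' y) ∨
        (x ∉ (⋃ k, (X k : Set V)) ∧ ∀ Z : Finset V, (Z : Set V) ⊆ (⋃ k, (X k : Set V)) →
          Reach D Z x y) := by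
      intro x hx
      induction hx using ReflTransGen.head_induction_on with
      | refl => exact .inr ⟨hyX, fun Z hZ => .refl fun h => hyX (hZ h)⟩
      | @head c d hcd _ ih =>
        obtain h | ⟨hd, h⟩ := ih
        · exact .inl h
        · have step : ∀ Z : Finset V, (Z : Set V) ⊆ (⋃ k, (X k : Set V)) → c ∉ Z →
              Reach D Z c y := fun Z hZ hcZ =>
            .trans ⟨hcZ, (h Z hZ).1, .single ⟨hcd.1, hcZ, (h Z hZ).1⟩⟩ (h Z hZ)
          by_cases hc : c ∈ ⋃ k, (X k : Set V)
          · exact .inl ⟨c, ⟨hc, hcd.2.1⟩, step⟩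
          · exact .inr ⟨hc, fun Z hZ => step Z hZ fun h => hc (hZ h)⟩
    have hx₀ : t (X 0) ∈ ⋃ k, (X k : Set V) := Set.mem_iUnion.2 ⟨1, ht' 0⟩
    obtain ⟨x, ⟨hx, hxf⟩, h⟩ | ⟨h, -⟩ := claim _ ((hf.isStrongComp _).path (ht (X 0)) (hy 0))
    · obtain ⟨k, hk⟩ := Set.mem_iUnion.1 hx
      obtain ⟨hxS, hno⟩ := hS x (hX0 ▸ hxf)
      have hsub := hSX k x hk
      exact hno y (hf.anti hsub (hy _))
        (h _ (fun z hz => Set.mem_iUnion.2 ⟨k + 1, hsub hz⟩) hxS)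
    · exact h hx₀
  refine ⟨X, hmono, fun n => ⟨_, ht' n, ht _⟩, hconn, fun Y => ?_⟩
  have hY : ∃ n, ∀ y ∈ Y, y ∉ f (X n) := by
    induction Y using Finset.induction_on with
    | empty => exact ⟨0, by simp⟩
    | insert a Y _ ih =>
      obtain ⟨n, hn⟩ := ih
      obtain ⟨m, hm⟩ := hempty a
      refine ⟨max n m, fun y hy => ?_⟩
      obtain rfl | hy := Finset.mem_insert.1 hy
      · exact fun h => hm (hf.anti (hmono (le_max_right _ _)) h)
      · exact fun h => hn y hy (hf.anti (hmono (le_max_left _ _)) h)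
  obtain ⟨n, hn⟩ := hY
  obtain ⟨z, hz⟩ := (hf.isStrongComp (X n ∪ Y)).nonempty
  have := (hf.isStrongComp Y).subset_of_connected (A := f (X n)) (fun x hx hxY => hn x hxY hx)
    (fun x hx y hy => (hf.isStrongComp _).path hx hy) (hf.anti Finset.subset_union_left hz)
    (hf.anti Finset.subset_union_right hz)
  exact ⟨n, Set.inter_subset_right.trans this⟩

theorem IsDirection.exists_determiningSeq (hf : IsDirection D f) :
    ∃ X, IsDeterminingSeq D f X := by
  by_cases hA : ∀ X, (reachesDirection D f ∩ f X).Nonempty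
  · by_cases hB : ∀ X, (reachesDirection (DTop.reverse D) f ∩ f X).Nonempty
    · exact hf.exists_determiningSeq_of_meets hA hB
    · push Not at hB
      obtain ⟨X₀, h⟩ := hB
      obtain ⟨X, hX⟩ := hf.reverse.exists_determiningSeq_of_disjoint X₀ fun x hx hx' =>
        h.le ⟨hx', hx⟩
      exact ⟨X, hX.reverse⟩
  · push Not at hA
    obtain ⟨X₀, h⟩ := hA
    exact hf.exists_determiningSeq_of_disjoint X₀ fun x hx hx' => h.le ⟨hx', hx⟩

theorem exists_path_of_transGen {r : V → V → Prop} {x y : V} (h : TransGen r x y) :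
    ∃ (p : ℕ → V) (L : ℕ), p 0 = x ∧ p (L + 1) = y ∧ ∀ i ≤ L, r (p i) (p (i + 1)) := by
  induction h using TransGen.head_induction_on with
  | @single a h => exact ⟨fun n => if n = 0 then a else y, 0, by simp, by simp, by simpa using h⟩
  | @head a c hac _ ih =>
    obtain ⟨p, L, h0, hL, hp⟩ := ih
    refine ⟨fun n => Nat.casesOn n a p, L + 1, rfl, hL, fun i hi => ?_⟩
    cases i with
    | zero => simpa [h0] using hac
    | succ i => exact hp i (by omega)

/-- Infinitely many consecutive finite walks can be concatenated. -/
theorem exists_concat {r : ℕ → V → V → Prop} {v : ℕ → V}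
    (h : ∀ n, TransGen (r n) (v n) (v (n + 1))) :
    ∃ (w : ℕ → V) (k : ℕ → ℕ), Filter.Tendsto k Filter.atTop Filter.atTop ∧
      ∀ i, r (k i) (w i) (w (i + 1)) := by
  choose p L h0 hL hp using fun n => exists_path_of_transGen (h n)
  let σ : ℕ → ℕ × ℕ := fun n => Nat.rec (0, 0)
    (fun _ s => if s.2 + 1 ≤ L s.1 then (s.1, s.2 + 1) else (s.1 + 1, 0)) n
  have hσ : ∀ n, σ (n + 1) = if (σ n).2 + 1 ≤ L (σ n).1 then ((σ n).1, (σ n).2 + 1)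
      else ((σ n).1 + 1, 0) := fun n => rfl
  have hle : ∀ n, (σ n).2 ≤ L (σ n).1 := by
    intro n
    induction n with
    | zero => exact Nat.zero_le _
    | succ n ih =>
      rw [hσ]
      split_ifs with h
      · exact h
      · exact Nat.zero_le _
  have hmono : Monotone fun n => (σ n).1 := monotone_nat_of_le_succ fun n => by
    rw [hσ]
    split_ifs <;> simp
  have hreach : ∀ n, ∃ m, σ m = (n, 0) := by
    intro n
    induction n with
    | zero => exact ⟨0, rfl⟩
    | succ n ih =>
      obtain ⟨m, hm⟩ := ih
      have : ∀ i ≤ L n, σ (m + i) = (n, i) := by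
        intro i
        induction i with
        | zero => intro _; exact hm
        | succ i ih =>
          intro hi
          rw [← add_assoc, hσ, ih (by omega), if_pos hi]
      refine ⟨m + L n + 1, ?_⟩
      rw [hσ, this _ le_rfl, if_neg (by simp)]
  refine ⟨fun n => p (σ n).1 (σ n).2, fun n => (σ n).1, ?_, fun n => ?_⟩
  · refine Filter.tendsto_atTop_atTop_of_monotone hmono fun n => ?_
    obtain ⟨m, hm⟩ := hreach n
    exact ⟨m, by simp [hm]⟩
  · have := hp (σ n).1 (σ n).2 (hle n)
    simp only [hσ]
    split_ifs with h
    · exact this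
    · have e : (σ n).2 = L (σ n).1 := by have := hle n; omega
      rw [e] at this ⊢
      rwa [hL, ← h0 ((σ n).1 + 1)] at this

/-- Every direction of a digraph is induced by an infinite walk. -/
theorem IsDirection.exists_walk (hf : IsDirection D f) :
    ∃ w : ℕ → V, (∀ n, D.Adj (w n) (w (n + 1))) ∧ ∀ X, ∃ N, ∀ n, N ≤ n → w n ∈ f X := by
  obtain ⟨X, hX⟩ := hf.exists_determiningSeq
  choose v hv hvf using hX.nonempty
  have hmem : ∀ n, v n ∈ (⋃ k, (X k : Set V)) := fun n => Set.mem_iUnion.2 ⟨n + 1, hv n⟩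
  have htrans : ∀ n, TransGen (fun a b => D.Adj a b ∧ a ∈ (⋃ k, (X k : Set V)) ∩ f (X n) ∧
        b ∈ (⋃ k, (X k : Set V)) ∩ f (X n)) (v n) (v (n + 1)) := by
    intro n
    obtain h | h := reflTransGen_iff_eq_or_transGen.1 (hX.connected n (v n) ⟨hmem n, hvf n⟩
      (v (n + 1)) ⟨hmem _, hf.anti (hX.mono n.le_succ) (hvf (n + 1))⟩)
    · have := (hf.isStrongComp _).notMem (hvf (n + 1))
      rw [h] at this
      exact (this (hv n)).elim
    · exact h
  obtain ⟨w, k, hk, hw⟩ := exists_concat htrans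
  refine ⟨w, fun n => (hw n).1, fun Y => ?_⟩
  obtain ⟨n, hn⟩ := hX.cofinal Y
  obtain ⟨N, hN⟩ := Filter.eventually_atTop.1 (hk.eventually_ge_atTop n)
  exact ⟨N, fun i hi => hn ⟨(hw i).2.1.1, hf.anti (hX.mono (hN i hi)) (hw i).2.1.2⟩⟩

end Directions

section Ends

open Relation

variable {V : Type u} {D : Digraph V}

theorem endComp_mk {X : Finset V} (r : {r : ℕ → V // IsSolidRay D r}) {C : Set V}
    (hC : IsStrongComp D X C) (hr : HasTailIn r.1 C) :
    endComp D X (Quotient.mk (raySetoid D) r) = C := by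
  ext v
  change HasTailIn r.1 (strongComp D X v) ↔ v ∈ C
  constructor
  · rintro ⟨N, hN⟩
    have hv : v ∉ X := (hN N le_rfl).1.1
    have e := IsStrongComp.eq_of_tail ⟨v, hv, rfl⟩ hC ⟨N, hN⟩ hr
    rw [← e]
    exact ⟨.refl hv, .refl hv⟩
  · obtain ⟨w, hw, rfl⟩ := hC
    intro hv
    rwa [strongComp_eq hv]

theorem isStrongComp_endComp (X : Finset V) (ω : DEnd D) : IsStrongComp D X (endComp D X ω) := by
  induction ω using Quotient.inductionOn with
  | h r =>
    obtain ⟨C, hC, hr⟩ := r.2.2 X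
    rwa [endComp_mk r hC hr]

theorem exists_ray_of_end (ω : DEnd D) :
    ∃ r : ℕ → V, IsRay D r ∧ ∀ X, HasTailIn r (endComp D X ω) := by
  induction ω using Quotient.inductionOn with
  | h r =>
    refine ⟨r.1, r.2.1, fun X => ?_⟩
    obtain ⟨C, hC, hr⟩ := r.2.2 X
    rwa [endComp_mk r hC hr]

theorem end_ext {ω η : DEnd D} (h : ∀ X, endComp D X ω = endComp D X η) : ω = η := by
  induction ω using Quotient.inductionOn with
  | h r =>
    induction η using Quotient.inductionOn with
    | h s =>
      refine Quotient.sound fun X => ?_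
      obtain ⟨C, hC, hr⟩ := r.2.2 X
      obtain ⟨C', hC', hs⟩ := s.2.2 X
      have := h X
      rw [endComp_mk r hC hr, endComp_mk s hC' hs] at this
      exact ⟨C, hC, hr, this ▸ hs⟩

theorem exists_endComp_ne {ω η : DEnd D} (h : ω ≠ η) :
    ∃ X, endComp D X ω ≠ endComp D X η := by
  by_contra! h'
  exact h (end_ext h')

theorem isDirection_endComp (ω : DEnd D) : IsDirection D fun X => endComp D X ω := by
  refine ⟨fun X => isStrongComp_endComp X ω, fun X Y hXY => ?_⟩
  obtain ⟨r, -, hr⟩ := exists_ray_of_end ω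
  obtain ⟨N, hN⟩ := hr X
  obtain ⟨M, hM⟩ := hr Y
  have hY := isStrongComp_endComp Y ω
  exact (isStrongComp_endComp X ω).subset_of_connected (fun x hx hxX => hY.notMem hx (hXY hxX))
    (fun x hx y hy => hY.path hx hy) (hM (max N M) (le_max_right _ _)) (hN _ (le_max_left _ _))

theorem Reach.of_induce {A : Set V} {Y : Finset A} {X : Finset V} (hXY : ∀ a : A, ↑a ∈ X → a ∈ Y)
    {a b : A} (h : Reach (induce D A) Y a b) : Reach D X a b :=
  ⟨fun h' => h.1 (hXY _ h'), fun h' => h.2.1 (hXY _ h'),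
    h.2.2.lift _ fun _ _ h => ⟨h.1, fun h' => h.2.1 (hXY _ h'), fun h' => h.2.2 (hXY _ h')⟩⟩

/-- A direction each of whose components meets `A`, where `D[A]` is solid, is refined by a
direction of `D[A]`. -/
theorem IsDirection.exists_induce {g : Finset V → Set V} (hg : IsDirection D g) {A : Set V}
    (hA : IsSolid (induce D A)) (h : ∀ X, (g X ∩ A).Nonempty) :
    ∃ f, IsDirection (induce D A) f ∧ ∀ X, ∃ Y, f Y ⊆ Subtype.val ⁻¹' g X := by
  classical
  let F : Filter A := ⨅ X, Filter.principal (Subtype.val ⁻¹' g X)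
  have : Nonempty A := by
    obtain ⟨x, -, hx⟩ := h ∅
    exact ⟨⟨x, hx⟩⟩
  have hF : F.NeBot := by
    refine Filter.iInf_neBot_of_directed (fun X Y => ⟨X ∪ Y, ?_, ?_⟩) fun X => ?_
    · exact Filter.principal_mono.2 (Set.preimage_mono (hg.anti Finset.subset_union_left))
    · exact Filter.principal_mono.2 (Set.preimage_mono (hg.anti Finset.subset_union_right))
    · obtain ⟨x, hx, hxA⟩ := h X
      exact Filter.principal_neBot_iff.2 ⟨⟨x, hxA⟩, hx⟩
  let U : Ultrafilter A := Ultrafilter.of F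
  have hU : ∀ X, Subtype.val ⁻¹' g X ∈ U := fun X =>
    Ultrafilter.of_le F (Filter.mem_iInf_of_mem X (Filter.mem_principal_self _))
  have hcomp : ∀ Y : Finset A, ∃ C, IsStrongComp (induce D A) Y C ∧ C ∈ U := by
    intro Y
    refine (Ultrafilter.finite_sUnion_mem_iff (hA Y)).1 ?_
    refine Filter.mem_of_superset (hU (Y.map (Function.Embedding.subtype _))) fun a ha => ?_
    have haY : a ∉ Y := fun h => (hg.isStrongComp _).notMem ha (by simpa using h)
    exact ⟨_, ⟨a, haY, rfl⟩, .refl haY, .refl haY⟩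
  choose f hf hfU using hcomp
  refine ⟨f, ⟨hf, fun X Y hXY => ?_⟩, fun X => ⟨X.subtype (· ∈ A), fun a ha => ?_⟩⟩
  · obtain ⟨z, hzX, hzY⟩ := U.nonempty_of_mem (Filter.inter_mem (hfU X) (hfU Y))
    exact (hf X).subset_of_connected (fun x hx hxX => (hf Y).notMem hx (hXY hxX))
      (fun x hx y hy => (hf Y).path hx hy) hzY hzX
  · obtain ⟨z, hz, hzX⟩ := U.nonempty_of_mem
      (Filter.inter_mem (hfU (X.subtype (· ∈ A))) (hU X))
    refine (hg.isStrongComp X).mem_of_reach hzX hzX ?_ ?_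
    · exact ((hf _).reach hz ha).of_induce fun a ha => by simpa using ha
    · exact ((hf _).reach ha hz).of_induce fun a ha => by simpa using ha

theorem IsDirection.exists_walk_induce {g : Finset V → Set V} (hg : IsDirection D g) {A : Set V}
    (hA : IsSolid (induce D A)) (h : ∀ X, (g X ∩ A).Nonempty) :
    (∃ w : ℕ → V, (∀ n, w n ∈ A) ∧ (∀ n, D.Adj (w n) (w (n + 1))) ∧
      ∀ X, ∃ N, ∀ n, N ≤ n → w n ∈ g X) ∧
    ∃ w : ℕ → V, (∀ n, w n ∈ A) ∧ (∀ n, D.Adj (w (n + 1)) (w n)) ∧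
      ∀ X, ∃ N, ∀ n, N ≤ n → w n ∈ g X := by
  obtain ⟨f, hf, hfg⟩ := hg.exists_induce hA h
  have key : ∀ w : ℕ → A, (∀ X, ∃ N, ∀ n, N ≤ n → w n ∈ f X) →
      ∀ X, ∃ N, ∀ n, N ≤ n → (w n : V) ∈ g X := by
    intro w hw X
    obtain ⟨Y, hY⟩ := hfg X
    obtain ⟨N, hN⟩ := hw Y
    exact ⟨N, fun n hn => hY (hN n hn)⟩
  obtain ⟨w, hw, hwf⟩ := hf.exists_walk
  obtain ⟨w', hw', hwf'⟩ := hf.reverse.exists_walk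
  exact ⟨⟨fun n => w n, fun n => (w n).2, hw, key w hwf⟩,
    fun n => w' n, fun n => (w' n).2, hw', key w' hwf'⟩

end Ends

section Topology

open Topology

variable {V : Type u} {D : Digraph V}

theorem Edge.ext' {e e' : Edge D} (ht : e.tail = e'.tail) (hh : e.head = e'.head) : e = e' := by
  cases e
  cases e'
  simp only at ht hh
  subst ht hh
  rfl

theorem Edge.tail_ne_head (hD : ∀ v, ¬ D.Adj v v) (e : Edge D) : e.tail ≠ e.head := by
  obtain ⟨x, y, h⟩ := e
  intro hxy
  simp only at hxy
  subst hxy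
  cases x with
  | vtx v => exact hD v h
  | lim ω => exact h.1 rfl

/-! ### Points of an edge -/

theorem edgePt_zero (e : Edge D) : edgePt e 0 = .node e.tail := by simp [edgePt]

theorem edgePt_one (e : Edge D) : edgePt e 1 = .node e.head := by simp [edgePt]

theorem edgePt_of_mem_Ioo (e : Edge D) {t : unitInterval} (h : 0 < (t : ℝ) ∧ (t : ℝ) < 1) :
    edgePt e t = .inner e ⟨t, h⟩ := by simp [edgePt, h.1, h.2]

theorem edgePt_coe (e : Edge D) (t : Set.Ioo (0 : ℝ) 1) :
    edgePt e ⟨t, t.2.1.le, t.2.2.le⟩ = .inner e t :=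
  edgePt_of_mem_Ioo e (t := ⟨t, t.2.1.le, t.2.2.le⟩) t.2

theorem unitInterval_cases (t : unitInterval) : t = 0 ∨ t = 1 ∨ (0 < (t : ℝ) ∧ (t : ℝ) < 1) := by
  rcases t.2.1.eq_or_lt with h | h
  · exact .inl (Subtype.ext h.symm)
  · rcases t.2.2.eq_or_lt with h' | h'
    · exact .inr (.inl (Subtype.ext h'))
    · exact .inr (.inr ⟨h, h'⟩)

theorem edgePt_injective {e : Edge D} (he : e.tail ≠ e.head) : Function.Injective (edgePt e) := by
  intro s t h
  rcases unitInterval_cases s with rfl | rfl | hs <;>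
    rcases unitInterval_cases t with rfl | rfl | ht <;>
    simp_all [edgePt_zero, edgePt_one, edgePt_of_mem_Ioo, eq_comm, Subtype.ext_iff]

theorem eq_of_inner_mem_closedEdge {e e' : Edge D} {t : Set.Ioo (0 : ℝ) 1}
    (h : Space.inner e t ∈ closedEdge e') : e = e' := by
  obtain ⟨s, hs⟩ := h
  rcases unitInterval_cases s with rfl | rfl | hs'
  · simp [edgePt_zero] at hs
  · simp [edgePt_one] at hs
  · rw [edgePt_of_mem_Ioo _ hs'] at hs
    cases hs
    rfl

theorem continuous_edgePt (e : Edge D) : Continuous (edgePt e) := by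
  refine continuous_generateFrom_iff.2 fun U hU => ?_
  have c : Continuous fun t : unitInterval => (t : ℝ) := continuous_subtype_val
  have key : ∀ p : unitInterval → Prop, (∀ t, edgePt e t ∈ U ↔ p t) → IsOpen {t | p t} →
      IsOpen (edgePt e ⁻¹' U) := fun p hp h => by
    convert h using 1
    ext t
    exact hp t
  have half : ∀ (R P Q : Prop) (ε : ℝ),
      IsOpen {t : unitInterval | R ∨ (P ∧ (t : ℝ) < ε ∧ (t : ℝ) < 1) ∨
        (Q ∧ 1 - ε < (t : ℝ) ∧ 0 < (t : ℝ))} := fun R P Q ε =>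
    isOpen_const.union <| .union
      (.and isOpen_const (.and (isOpen_lt c continuous_const) (isOpen_lt c continuous_const)))
      (.and isOpen_const (.and (isOpen_lt continuous_const c) (isOpen_lt continuous_const c)))
  have ball : ∀ (P : Prop) (z ε : ℝ),
      IsOpen {t : unitInterval | P ∧ (0 < (t : ℝ) ∧ (t : ℝ) < 1) ∧ |(t : ℝ) - z| < ε} :=
    fun P z ε => by
      refine .and isOpen_const (.and (.and ?_ ?_) ?_)
      · exact isOpen_lt continuous_const c
      · exact isOpen_lt c continuous_const
      · exact isOpen_lt (c.sub continuous_const).abs continuous_const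
  have bundle : ∀ X A B z ε, U = bundleNhd D X A B z ε → IsOpen (edgePt e ⁻¹' U) := by
    rintro X A B z ε rfl
    refine key _ (fun t => ?_) (ball (InBundle X A B e) z ε)
    simp only [bundleNhd, edgeBall, Set.mem_iUnion]
    rcases unitInterval_cases t with rfl | rfl | ht
    · simp [edgePt_zero]
    · simp [edgePt_one]
    · rw [edgePt_of_mem_Ioo _ ht]
      constructor
      · rintro ⟨e', he', t', ht', h⟩
        cases h
        exact ⟨he', ht, ht'⟩
      · rintro ⟨he, -, h⟩
        exact ⟨e, he, _, h, rfl⟩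
  cases hU with
  | vertex v ε hε =>
    refine key _ (fun t => ?_) (half False (e.tail = .vtx v) (e.head = .vtx v) ε)
    rcases unitInterval_cases t with rfl | rfl | ht
    · simp [edgePt_zero, star, hε]
    · simp [edgePt_one, star, hε]
    · simp only [edgePt_of_mem_Ioo _ ht, star, Set.mem_ofPred_eq, ht, and_true, false_or]
  | edge e' v w hv hw z ε hε =>
    refine key _ (fun t => ?_) (ball (e = e') z ε)
    rcases unitInterval_cases t with rfl | rfl | ht
    · simp [edgePt_zero, edgeBall]
    · simp [edgePt_one, edgeBall]
    · simp only [edgePt_of_mem_Ioo _ ht, edgeBall, Set.mem_ofPred_eq]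
      constructor
      · rintro ⟨t', ht', h⟩
        cases h
        exact ⟨rfl, ht, ht'⟩
      · rintro ⟨rfl, -, h⟩
        exact ⟨_, h, rfl⟩
  | endPoint X ω ε hε =>
    refine key _ (fun t => ?_) (half (InComp D X (endComp D X ω) e.tail ∧
      InComp D X (endComp D X ω) e.head) (InComp D X (endComp D X ω) e.tail)
      (InComp D X (endComp D X ω) e.head) ε)
    rcases unitInterval_cases t with rfl | rfl | ht
    · simp +contextual [edgePt_zero, endNhd, hε]
    · simp +contextual [edgePt_one, endNhd, hε]
    · simp only [edgePt_of_mem_Ioo _ ht, endNhd, Set.mem_ofPred_eq, ht, and_true]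
  | endEnd e' ω η hω hη X hX z ε hε => exact bundle _ _ _ _ _ rfl
  | vertexEnd e' v ω hv hω X hX z ε hε => exact bundle _ _ _ _ _ rfl
  | endVertex e' v ω hω hv X hX z ε hε => exact bundle _ _ _ _ _ rfl

/-! ### Neighbourhoods of nodes -/

/-- The strong component of `D - X` or the single vertex of `X` to which a node belongs. -/
def nodeClass (X : Finset V) : Node D → Set V
  | .vtx v => {v}
  | .lim ω => endComp D X ω

/-- The node `x` is an end or a vertex in `X`. -/
def IsCovered (X : Finset V) : Node D → Prop
  | .vtx v => v ∈ X
  | .lim _ => True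

theorem inComp_nodeClass (X : Finset V) (x : Node D) : InComp D X (nodeClass X x) x := by
  cases x with
  | vtx v => exact Set.mem_singleton v
  | lim ω => rfl

theorem nodeClass_eq_of_inComp {X : Finset V} {x y z : Node D} (hx : IsCovered X x)
    (hy : IsCovered X y) (hxz : InComp D X (nodeClass X x) z)
    (hyz : InComp D X (nodeClass X y) z) : nodeClass X x = nodeClass X y := by
  cases z with
  | lim ω => exact hxz.symm.trans hyz
  | vtx v =>
    cases x with
    | vtx a =>
      cases y with
      | vtx b => rw [← Set.mem_singleton_iff.1 hxz, ← Set.mem_singleton_iff.1 hyz]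
      | lim η =>
        rw [← Set.mem_singleton_iff.1 hxz] at hx
        exact ((isStrongComp_endComp X η).notMem hyz hx).elim
    | lim ω =>
      cases y with
      | vtx b =>
        rw [← Set.mem_singleton_iff.1 hyz] at hy
        exact ((isStrongComp_endComp X ω).notMem hxz hy).elim
      | lim η => exact (isStrongComp_endComp X ω).eq_of_mem (isStrongComp_endComp X η) hxz hyz

theorem exists_nodeClass_ne {x y : Node D} (h : x ≠ y) :
    ∃ X, IsCovered X x ∧ IsCovered X y ∧ nodeClass X x ≠ nodeClass X y := by
  classical
  have key : ∀ (v : V) (ω : DEnd D), endComp D {v} ω ≠ {v} := fun v ω h =>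
    (isStrongComp_endComp {v} ω).notMem (x := v) (by simp [h]) (by simp)
  cases x with
  | vtx a =>
    cases y with
    | vtx b =>
      exact ⟨{a, b}, by simp [IsCovered], by simp [IsCovered], fun h' =>
        h (congrArg _ (Set.singleton_injective h'))⟩
    | lim η => exact ⟨{a}, by simp [IsCovered], trivial, fun h' => key a η h'.symm⟩
  | lim ω =>
    cases y with
    | vtx b => exact ⟨{b}, trivial, by simp [IsCovered], fun h' => key b ω h'⟩
    | lim η =>
      obtain ⟨X, hX⟩ := exists_endComp_ne (ω := ω) (η := η) fun h' => h (congrArg _ h')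
      exact ⟨X, trivial, trivial, hX⟩

/-- The set `Ĉ_ε(X, ω)` for an arbitrary set `C` in place of `C(X, ω)`. -/
def classNhd (D : Digraph V) (X : Finset V) (C : Set V) (ε : ℝ) : Set (Space D) :=
  {p | match p with
    | .node x => InComp D X C x
    | .inner e t =>
        (InComp D X C e.tail ∧ InComp D X C e.head) ∨
        (InComp D X C e.tail ∧ (t : ℝ) < ε) ∨
        (InComp D X C e.head ∧ 1 - ε < (t : ℝ))}

theorem isOpen_classNhd (hD : ∀ v, ¬ D.Adj v v) {X : Finset V} {x : Node D} (hx : IsCovered X x)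
    {ε : ℝ} (hε : 0 < ε) : IsOpen (classNhd D X (nodeClass X x) ε) := by
  refine TopologicalSpace.isOpen_generateFrom_of_mem ?_
  cases x with
  | lim ω => exact .endPoint X ω ε hε
  | vtx v =>
    have hin : ∀ y : Node D, InComp D X {v} y ↔ y = .vtx v := by
      intro y
      cases y with
      | vtx w => simp [InComp]
      | lim η =>
        simp only [InComp, reduceCtorEq, iff_false]
        intro h
        exact (isStrongComp_endComp X η).notMem (x := v) (by simp [h]) hx
    suffices h : classNhd D X (nodeClass X (.vtx v)) ε = star D v ε from
      h ▸ IsBasicOpen.vertex v ε hε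
    ext p
    cases p with
    | node y => exact hin y
    | inner e t =>
      simp only [classNhd, star, nodeClass, Set.mem_ofPred_eq, hin]
      have : ¬ (e.tail = .vtx v ∧ e.head = .vtx v) := fun h =>
        e.tail_ne_head hD (h.1.trans h.2.symm)
      tauto

theorem mem_classNhd (X : Finset V) (x : Node D) (ε : ℝ) :
    Space.node x ∈ classNhd D X (nodeClass X x) ε := inComp_nodeClass X x

theorem disjoint_classNhd {X : Finset V} {x y : Node D} (hx : IsCovered X x)
    (hy : IsCovered X y) (hne : nodeClass X x ≠ nodeClass X y) :
    Disjoint (classNhd D X (nodeClass X x) (1 / 2)) (classNhd D X (nodeClass X y) (1 / 2)) := by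
  have key : ∀ z, InComp D X (nodeClass X x) z → InComp D X (nodeClass X y) z → False :=
    fun z h h' => hne (nodeClass_eq_of_inComp hx hy h h')
  refine Set.disjoint_left.2 fun p => ?_
  cases p with
  | node z => exact key z
  | inner e t =>
    rintro (⟨h, h'⟩ | ⟨h, h'⟩ | ⟨h, h'⟩) (⟨k, k'⟩ | ⟨k, k'⟩ | ⟨k, k'⟩)
    all_goals first
      | exact key _ h k
      | exact key _ h' k
      | exact key _ h k'
      | linarith

theorem exists_disjoint_nhds_nodes (hD : ∀ v, ¬ D.Adj v v) {x y : Node D} (h : x ≠ y) :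
    ∃ U W : Set (Space D), IsOpen U ∧ IsOpen W ∧ Space.node x ∈ U ∧ Space.node y ∈ W ∧
      Disjoint U W := by
  obtain ⟨X, hx, hy, hne⟩ := exists_nodeClass_ne h
  exact ⟨_, _, isOpen_classNhd hD hx one_half_pos, isOpen_classNhd hD hy one_half_pos,
    mem_classNhd X x _, mem_classNhd X y _, disjoint_classNhd hx hy hne⟩

/-! ### Neighbourhoods of inner points of edges -/

theorem inner_mem_bundleNhd {X : Finset V} {A B : Set V} {z ε : ℝ} {e : Edge D}
    {t : Set.Ioo (0 : ℝ) 1} :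
    Space.inner e t ∈ bundleNhd D X A B z ε ↔ InBundle X A B e ∧ |(t : ℝ) - z| < ε := by
  simp only [bundleNhd, edgeBall, Set.mem_iUnion]
  constructor
  · rintro ⟨e', he', t', ht', h⟩
    cases h
    exact ⟨he', ht'⟩
  · rintro ⟨he, h⟩
    exact ⟨e, he, t, h, rfl⟩

theorem node_notMem_bundleNhd {X : Finset V} {A B : Set V} {z ε : ℝ} {x : Node D} :
    Space.node x ∉ bundleNhd D X A B z ε := by
  simp [bundleNhd, edgeBall]

theorem isOpen_bundleNhd {X : Finset V} {e : Edge D} (ht : IsCovered X e.tail)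
    (hh : IsCovered X e.head) (hne : nodeClass X e.tail ≠ nodeClass X e.head)
    (z : Set.Ioo (0 : ℝ) 1) {ε : ℝ} (hε : 0 < ε) :
    IsOpen (bundleNhd D X (nodeClass X e.tail) (nodeClass X e.head) z ε) := by
  refine TopologicalSpace.isOpen_generateFrom_of_mem ?_
  rcases htail : e.tail with v | ω <;> rcases hhead : e.head with w | η <;>
    simp only [htail, hhead] at ht hh hne
  · have hin : ∀ (u : V) (y : Node D), u ∈ X → (InComp D X {u} y ↔ y = .vtx u) := by
      intro u y hu
      cases y with
      | vtx w => simp [InComp]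
      | lim η =>
        simp only [InComp, reduceCtorEq, iff_false]
        intro h
        exact (isStrongComp_endComp X η).notMem (x := u) (by simp [h]) hu
    suffices h : bundleNhd D X (nodeClass X (.vtx v)) (nodeClass X (.vtx w)) z ε =
        edgeBall e z ε from h ▸ IsBasicOpen.edge e v w htail hhead z ε hε
    ext p
    cases p with
    | node y => simp [node_notMem_bundleNhd, edgeBall]
    | inner e' t =>
      rw [inner_mem_bundleNhd, InBundle, nodeClass, nodeClass, hin v _ ht, hin w _ hh]
      constructor
      · rintro ⟨⟨h, h'⟩, h''⟩
        exact ⟨t, h'', by rw [Edge.ext' (h.trans htail.symm) (h'.trans hhead.symm)]⟩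
      · rintro ⟨t', h', h⟩
        cases h
        exact ⟨⟨htail, hhead⟩, h'⟩
  · exact .vertexEnd e v η htail hhead X ht z ε hε
  · exact .endVertex e w ω htail hhead X hh z ε hε
  · exact .endEnd e ω η htail hhead X hne z ε hε

theorem inBundle_self (X : Finset V) (e : Edge D) :
    InBundle X (nodeClass X e.tail) (nodeClass X e.head) e :=
  ⟨inComp_nodeClass X _, inComp_nodeClass X _⟩

theorem mem_bundleNhd (X : Finset V) (e : Edge D) (t : Set.Ioo (0 : ℝ) 1) {ε : ℝ} (hε : 0 < ε) :
    Space.inner e t ∈ bundleNhd D X (nodeClass X e.tail) (nodeClass X e.head) t ε :=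
  inner_mem_bundleNhd.2 ⟨inBundle_self X e, by simpa using hε⟩

/-- Distinct points of the same edge have disjoint neighbourhoods. -/
theorem exists_disjoint_nhds_edgePt (hD : ∀ v, ¬ D.Adj v v) (e : Edge D) {s t : unitInterval}
    (hst : s < t) : ∃ U W : Set (Space D), IsOpen U ∧ IsOpen W ∧ edgePt e s ∈ U ∧
      edgePt e t ∈ W ∧ Disjoint U W := by
  have hst' : (s : ℝ) < t := hst
  obtain ⟨X, hx, hy, hne⟩ := exists_nodeClass_ne (e.tail_ne_head hD)
  have key : ∀ z, InComp D X (nodeClass X e.tail) z → InComp D X (nodeClass X e.head) z → False :=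
    fun z h h' => hne (nodeClass_eq_of_inComp hx hy h h')
  set ε : ℝ := (t - s) / 2 with hε
  have hε0 : 0 < ε := by simp only [hε]; linarith
  rcases unitInterval_cases s with rfl | rfl | hs
  · rcases unitInterval_cases t with rfl | rfl | ht
    · exact (lt_irrefl _ hst).elim
    · rw [edgePt_zero, edgePt_one]
      exact exists_disjoint_nhds_nodes hD (e.tail_ne_head hD)
    · rw [edgePt_zero, edgePt_of_mem_Ioo _ ht]
      refine ⟨_, _, isOpen_classNhd hD hx hε0, isOpen_bundleNhd hx hy hne ⟨t, ht⟩ hε0,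
        mem_classNhd X _ _, mem_bundleNhd X e ⟨t, ht⟩ hε0, Set.disjoint_left.2 fun p => ?_⟩
      cases p with
      | node z => exact fun _ => node_notMem_bundleNhd
      | inner e' r =>
        rw [inner_mem_bundleNhd, abs_lt]
        rintro (⟨h, h'⟩ | ⟨h, h'⟩ | ⟨h, h'⟩) ⟨⟨k, k'⟩, k1, k2⟩
        · exact key _ h' k'
        · simp only [Set.Icc.coe_zero] at hε
          linarith
        · exact key _ h k'
  · exact (not_lt.2 t.2.2 hst').elim
  · rcases unitInterval_cases t with rfl | rfl | ht
    · exact (not_lt.2 s.2.1 hst').elim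
    · rw [edgePt_one, edgePt_of_mem_Ioo _ hs]
      refine ⟨_, _, isOpen_bundleNhd hx hy hne ⟨s, hs⟩ hε0, isOpen_classNhd hD hy hε0,
        mem_bundleNhd X e ⟨s, hs⟩ hε0, mem_classNhd X _ _, Set.disjoint_right.2 fun p => ?_⟩
      cases p with
      | node z => exact fun _ => node_notMem_bundleNhd
      | inner e' r =>
        rw [inner_mem_bundleNhd, abs_lt]
        rintro (⟨h, h'⟩ | ⟨h, h'⟩ | ⟨h, h'⟩) ⟨⟨k, k'⟩, k1, k2⟩
        · exact key _ k h
        · exact key _ k h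
        · simp only [Set.Icc.coe_one] at hε
          linarith
    · rw [edgePt_of_mem_Ioo _ hs, edgePt_of_mem_Ioo _ ht]
      refine ⟨_, _, isOpen_bundleNhd hx hy hne ⟨s, hs⟩ hε0,
        isOpen_bundleNhd hx hy hne ⟨t, ht⟩ hε0, mem_bundleNhd X e ⟨s, hs⟩ hε0,
        mem_bundleNhd X e ⟨t, ht⟩ hε0, Set.disjoint_left.2 fun p => ?_⟩
      cases p with
      | node z => exact fun _ => node_notMem_bundleNhd
      | inner e' r =>
        rw [inner_mem_bundleNhd, inner_mem_bundleNhd, abs_lt, abs_lt]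
        rintro ⟨-, h1, h2⟩ ⟨-, k1, k2⟩
        linarith

theorem t2Space_closedEdge (hD : ∀ v, ¬ D.Adj v v) (e : Edge D) : T2Space (closedEdge e) := by
  refine ⟨?_⟩
  rintro ⟨_, s, rfl⟩ ⟨_, t, rfl⟩ hne
  have hst : s ≠ t := fun h => hne (by rw [h])
  rcases hst.lt_or_gt with h | h
  · obtain ⟨U, W, hU, hW, hs, ht, hd⟩ := exists_disjoint_nhds_edgePt hD e h
    exact ⟨_, _, hU.preimage continuous_subtype_val, hW.preimage continuous_subtype_val, hs, ht,
      hd.preimage _⟩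
  · obtain ⟨U, W, hU, hW, hs, ht, hd⟩ := exists_disjoint_nhds_edgePt hD e h
    exact ⟨_, _, hW.preimage continuous_subtype_val, hU.preimage continuous_subtype_val, ht, hs,
      hd.symm.preimage _⟩

theorem isEmbedding_of_mem_closedEdge (hD : ∀ v, ¬ D.Adj v v) {e : Edge D} {K : Type*}
    [TopologicalSpace K] [CompactSpace K] {g : K → Space D} (hg : Continuous g)
    (hinj : Function.Injective g) (h : ∀ k, g k ∈ closedEdge e) : IsEmbedding g := by
  have := t2Space_closedEdge hD e
  have h1 : IsClosedEmbedding (fun k => (⟨g k, h k⟩ : closedEdge e)) :=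
    (hg.subtype_mk h).isClosedEmbedding fun a b hab => hinj (congrArg Subtype.val hab)
  exact IsEmbedding.subtypeVal.comp h1.isEmbedding

/-! ### Closures of vertex sets -/

theorem inner_notMem_closure (hD : ∀ v, ¬ D.Adj v v) (e : Edge D) (t : Set.Ioo (0 : ℝ) 1)
    (A : Set V) : Space.inner e t ∉ closure (vertexSet D A) := by
  obtain ⟨X, hx, hy, hne⟩ := exists_nodeClass_ne (e.tail_ne_head hD)
  intro h
  obtain ⟨_, hp, v, -, rfl⟩ := mem_closure_iff.1 h _ (isOpen_bundleNhd hx hy hne t one_pos)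
    (mem_bundleNhd X e t one_pos)
  exact node_notMem_bundleNhd hp

theorem vtx_mem_closure_iff {v : V} {A : Set V} :
    Space.node (.vtx v) ∈ closure (vertexSet D A) ↔ v ∈ A := by
  refine ⟨fun h => ?_, fun h => subset_closure ⟨v, h, rfl⟩⟩
  obtain ⟨_, hp, w, hw, rfl⟩ := mem_closure_iff.1 h (star D v 1)
    (TopologicalSpace.isOpen_generateFrom_of_mem (.vertex v 1 one_pos)) rfl
  cases hp
  exact hw

theorem endComp_inter_nonempty {ω : DEnd D} {A : Set V}
    (h : Space.node (.lim ω) ∈ closure (vertexSet D A)) (X : Finset V) :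
    (endComp D X ω ∩ A).Nonempty := by
  obtain ⟨_, hp, w, hw, rfl⟩ := mem_closure_iff.1 h (endNhd D X ω 1)
    (TopologicalSpace.isOpen_generateFrom_of_mem (.endPoint X ω 1 one_pos)) rfl
  exact ⟨w, hp, hw⟩

/-- A neighbourhood of an end `ω` in the subbasis of `|D|` is of the form `Ĉ_ε(X, ω)`. -/
theorem IsBasicOpen.eq_endNhd {U : Set (Space D)} (hU : IsBasicOpen D U) {ω : DEnd D}
    (h : Space.node (.lim ω) ∈ U) : ∃ X ε, U = endNhd D X ω ε := by
  cases hU with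
  | vertex v ε hε => cases h
  | edge e v w hv hw z ε hε => simp [edgeBall] at h
  | endPoint X η ε hε =>
    refine ⟨X, ε, ?_⟩
    have : endComp D X ω = endComp D X η := h
    simp only [endNhd, this]
  | endEnd => exact (node_notMem_bundleNhd h).elim
  | vertexEnd => exact (node_notMem_bundleNhd h).elim
  | endVertex => exact (node_notMem_bundleNhd h).elim

theorem node_mem_closure_univ (x : Node D) :
    Space.node x ∈ closure (vertexSet D Set.univ) := by
  cases x with
  | vtx v => exact subset_closure ⟨v, trivial, rfl⟩
  | lim ω =>
    obtain ⟨r, -, hr⟩ := exists_ray_of_end ω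
    have ht : Filter.Tendsto (fun n => Space.node (D := D) (.vtx (r n))) Filter.atTop
        (𝓝 (.node (.lim ω))) := by
      refine TopologicalSpace.tendsto_nhds_generateFrom_iff.2 fun U hU hω => ?_
      obtain ⟨X, ε, rfl⟩ := IsBasicOpen.eq_endNhd hU hω
      obtain ⟨N, hN⟩ := hr X
      exact Filter.mem_atTop_sets.2 ⟨N, fun n hn => hN n hn⟩
    exact mem_closure_of_tendsto ht (.of_forall fun n => ⟨r n, trivial, rfl⟩)

theorem node_mem_closure_or {A B : Set V} (h : IsCompl A B) (x : Node D) :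
    Space.node x ∈ closure (vertexSet D A) ∨ Space.node x ∈ closure (vertexSet D B) := by
  have := node_mem_closure_univ x
  have hu : A ∪ B = Set.univ := h.sup_eq_top
  rwa [← hu, vertexSet, Set.image_union, closure_union] at this

end Topology

section Jump

open Topology

variable {V : Type u} {D : Digraph V}

theorem IsLocalHomeoOnEdges.isOpen_preimage {α : C(unitInterval, Space D)}
    (hα : IsLocalHomeoOnEdges α) (S : Set (Edge D)) :
    IsOpen {s | s ∈ Set.Ioo 0 1 ∧ ∃ e ∈ S, α s ∈ openEdge e} := by
  refine isOpen_iff_mem_nhds.2 ?_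
  rintro s ⟨hs, e, he, hse⟩
  obtain ⟨a, b, hsab, h, hh⟩ := hα e s hs hse
  refine Filter.mem_of_superset (isOpen_Ioo.mem_nhds hsab) fun r hr => ?_
  refine ⟨⟨lt_of_le_of_lt a.2.1 hr.1, lt_of_lt_of_le hr.2 b.2.2⟩, e, he, ?_⟩
  rw [← hh ⟨r, hr⟩]
  exact (h _).2

theorem eq_of_mem_openEdge {e e' : Edge D} {p : Space D} (h : p ∈ openEdge e)
    (h' : p ∈ openEdge e') : e = e' := by
  obtain ⟨s, rfl⟩ := h
  obtain ⟨t, ht⟩ := h'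
  cases ht
  rfl

/-- A directed topological path whose points strictly between `t` and `u` are inner points of
edges stays on a single edge between `t` and `u`. -/
theorem IsLocalHomeoOnEdges.exists_edge {α : C(unitInterval, Space D)}
    (hα : IsLocalHomeoOnEdges α) {t u : unitInterval} (htu : t < u)
    (h : ∀ s ∈ Set.Ioo t u, ∃ e, α s ∈ openEdge e) :
    ∃ e, ∀ s ∈ Set.Ioo t u, α s ∈ openEdge e := by
  obtain ⟨s₀, hs₀⟩ := exists_between htu
  obtain ⟨e, he⟩ := h s₀ hs₀
  have h01 : ∀ s ∈ Set.Ioo t u, s ∈ Set.Ioo (0 : unitInterval) 1 := fun s hs =>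
    ⟨lt_of_le_of_lt t.2.1 hs.1, lt_of_lt_of_le hs.2 u.2.2⟩
  refine ⟨e, fun s hs => ?_⟩
  have hpre : IsPreconnected (Set.Ioo t u) := isPreconnected_Ioo
  by_contra hse
  obtain ⟨e', he'⟩ := h s hs
  have hne : e' ≠ e := fun h => hse (h ▸ he')
  obtain ⟨r, -, ⟨-, e₁, h₁, hr₁⟩, -, e₂, h₂, hr₂⟩ := hpre _ _ (hα.isOpen_preimage {e})
    (hα.isOpen_preimage {e}ᶜ)
    (fun r hr => by
      obtain ⟨e₁, he₁⟩ := h r hr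
      by_cases h' : e₁ = e
      · exact .inl ⟨h01 r hr, e₁, h', he₁⟩
      · exact .inr ⟨h01 r hr, e₁, h', he₁⟩)
    ⟨s₀, hs₀, h01 _ hs₀, e, rfl, he⟩ ⟨s, hs, h01 _ hs, e', hne, he'⟩
  exact h₂ ((eq_of_mem_openEdge hr₂ hr₁).trans h₁)

/-- A directed topological path that runs between two nodes through inner points of a single edge
can be reparametrized to that edge. -/
theorem IsDirectedTopPath.exists_param {α : C(unitInterval, Space D)}
    (hα : IsDirectedTopPath α) {t u : unitInterval} (htu : t < u) {x y : Node D}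
    (ht : α t = .node x) (hu : α u = .node y) {e : Edge D}
    (h : ∀ s ∈ Set.Ioo t u, α s ∈ openEdge e) :
    ∃ σ : unitInterval → unitInterval, Continuous σ ∧ σ t = 0 ∧ σ u = 1 ∧
      Set.InjOn σ (Set.Icc t u) ∧ Set.univ ⊆ σ '' Set.Icc t u ∧
      ∀ s ∈ Set.Ioo t u, α s = edgePt e (σ s) := by
  have : Nonempty (Set.Ioo (0 : ℝ) 1) := ⟨⟨1 / 2, by norm_num, by norm_num⟩⟩
  choose! τ hτ using h
  obtain ⟨s₀, hs₀⟩ := exists_between htu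
  obtain ⟨a, b, hab, H, hH⟩ := hα.1 e s₀
    ⟨lt_of_le_of_lt t.2.1 hs₀.1, lt_of_lt_of_le hs₀.2 u.2.2⟩ ⟨_, hτ s₀ hs₀⟩
  have hmem : ∀ s ∈ Set.Ioo a b, α s ∈ openEdge e := fun s hs => hH ⟨s, hs⟩ ▸ (H _).2
  have hta : t ≤ a := by
    by_contra! hlt
    obtain ⟨z, hz⟩ := hmem t ⟨hlt, hs₀.1.trans hab.2⟩
    rw [ht] at hz
    cases hz
  have hbu : b ≤ u := by
    by_contra! hlt
    obtain ⟨z, hz⟩ := hmem u ⟨hab.1.trans hs₀.2, hlt⟩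
    rw [hu] at hz
    cases hz
  have hsub : Set.Ioo a b ⊆ Set.Ioo t u := Set.Ioo_subset_Ioo hta hbu
  have hsurj : ∀ z, ∃ s ∈ Set.Ioo a b, τ s = z := by
    intro z
    obtain ⟨s, hs⟩ := H.surjective ⟨.inner e z, z, rfl⟩
    refine ⟨s, s.2, ?_⟩
    have h1 := hH s
    rw [hs, ← hτ s (hsub s.2)] at h1
    cases h1
    rfl
  have hmono : ∀ s ∈ Set.Ioo t u, ∀ s' ∈ Set.Ioo t u, s ≤ s' → τ s ≤ τ s' := by
    intro s hs s' hs' hle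
    have hc : ∀ r ∈ Set.Ioo t u, α r = edgePt e ⟨τ r, (τ r).2.1.le, (τ r).2.2.le⟩ :=
      fun r hr => by rw [edgePt_coe, hτ r hr]
    exact hα.2 e s s' (fun r hr =>
      ⟨_, (hc r ⟨lt_of_lt_of_le hs.1 hr.1, lt_of_le_of_lt hr.2 hs'.2⟩).symm⟩) s
      ⟨le_rfl, hle⟩ s' ⟨hle, le_rfl⟩ hle _ _ (hc s hs) (hc s' hs')
  have hat : a = t := by
    refine le_antisymm ?_ hta
    by_contra! hlt
    have ha : a ∈ Set.Ioo t u := ⟨hlt, hab.1.trans hs₀.2⟩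
    obtain ⟨z, hz0, hz⟩ := exists_between (τ a).2.1
    obtain ⟨s, hs, hsz⟩ := hsurj ⟨z, hz0, hz.trans (τ a).2.2⟩
    have := hmono a ha s (hsub hs) hs.1.le
    rw [hsz] at this
    exact (not_le.2 hz) this
  have hbt : b = u := by
    refine le_antisymm hbu ?_
    by_contra! hlt
    have hb : b ∈ Set.Ioo t u := ⟨hs₀.1.trans hab.2, hlt⟩
    obtain ⟨z, hz, hz1⟩ := exists_between (τ b).2.2
    obtain ⟨s, hs, hsz⟩ := hsurj ⟨z, (τ b).2.1.trans hz, hz1⟩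
    have := hmono s (hsub hs) b hb hs.2.le
    rw [hsz] at this
    exact (not_le.2 hz) this
  subst hat hbt
  have hinj : ∀ s ∈ Set.Ioo a b, ∀ s' ∈ Set.Ioo a b, τ s = τ s' → s = s' := by
    intro s hs s' hs' hss
    have : H ⟨s, hs⟩ = H ⟨s', hs'⟩ := Subtype.ext (by rw [hH, hH, ← hτ s hs, ← hτ s' hs', hss])
    simpa using H.injective this
  let σ : unitInterval → unitInterval := fun s =>
    if s ≤ a then 0 else if b ≤ s then 1 else ⟨τ s, (τ s).2.1.le, (τ s).2.2.le⟩
  have hσ1 : ∀ s ≤ a, σ s = 0 := fun s hs => if_pos hs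
  have hσ2 : ∀ s, b ≤ s → σ s = 1 := fun s hs => by
    simp only [σ]
    rw [if_neg (not_le.2 (lt_of_lt_of_le htu hs)), if_pos hs]
  have hσ3 : ∀ s ∈ Set.Ioo a b, σ s = ⟨τ s, (τ s).2.1.le, (τ s).2.2.le⟩ := fun s hs => by
    simp only [σ]
    rw [if_neg (not_le.2 hs.1), if_neg (not_le.2 hs.2)]
  have hcases : ∀ s, s ≤ a ∨ b ≤ s ∨ s ∈ Set.Ioo a b := fun s => by
    rcases le_or_gt s a with h | h
    · exact .inl h
    · rcases le_or_gt b s with h' | h'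
      · exact .inr (.inl h')
      · exact .inr (.inr ⟨h, h'⟩)
  have hσmono : Monotone σ := by
    intro s s' hss
    rcases hcases s with h | h | h
    · rw [hσ1 s h]
      exact unitInterval.nonneg'
    · rw [hσ2 s' (h.trans hss)]
      exact unitInterval.le_one'
    · rcases hcases s' with h' | h' | h'
      · exact (not_lt.2 (hss.trans h') h.1).elim
      · rw [hσ2 s' h']
        exact unitInterval.le_one'
      · rw [hσ3 s h, hσ3 s' h']
        exact hmono s h s' h' hss
  have hσsurj : Set.univ ⊆ σ '' Set.Icc a b := by
    intro z _
    rcases unitInterval_cases z with rfl | rfl | hz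
    · exact ⟨a, ⟨le_rfl, htu.le⟩, hσ1 a le_rfl⟩
    · exact ⟨b, ⟨htu.le, le_rfl⟩, hσ2 b le_rfl⟩
    · obtain ⟨s, hs, hsz⟩ := hsurj ⟨z, hz⟩
      refine ⟨s, Set.Ioo_subset_Icc_self hs, ?_⟩
      rw [hσ3 s hs, hsz]
  refine ⟨σ, hσmono.continuous_of_surjective fun z => ?_, hσ1 _ le_rfl, hσ2 _ le_rfl, ?_, hσsurj,
    fun s hs => ?_⟩
  · obtain ⟨s, -, hs⟩ := hσsurj (Set.mem_univ z)
    exact ⟨s, hs⟩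
  · have hinj' : ∀ s ∈ Set.Icc a b, ∀ s' ∈ Set.Icc a b, s < s' → σ s ≠ σ s' := by
      intro s hs s' hs' hlt heq
      obtain ⟨r, hr, hr'⟩ := exists_between hlt
      obtain ⟨r', hrr', hr''⟩ := exists_between hr'
      have e1 : σ r = σ r' := le_antisymm (hσmono hrr'.le)
        ((hσmono hr''.le).trans (heq.symm.le.trans (hσmono hr.le)))
      have m1 : r ∈ Set.Ioo a b := ⟨lt_of_le_of_lt hs.1 hr, lt_of_lt_of_le hr' hs'.2⟩
      have m2 : r' ∈ Set.Ioo a b := ⟨m1.1.trans hrr', lt_of_lt_of_le hr'' hs'.2⟩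
      rw [hσ3 r m1, hσ3 r' m2] at e1
      exact hrr'.ne (hinj r m1 r' m2 (Subtype.ext (congrArg (fun z : unitInterval => (z : ℝ)) e1)))
    intro s hs s' hs' heq
    rcases lt_trichotomy s s' with h | h | h
    · exact (hinj' s hs s' hs' h heq).elim
    · exact h
    · exact (hinj' s' hs' s hs h heq.symm).elim
  · rw [hσ3 s hs, edgePt_coe, hτ s hs]

theorem eq_node_of_mem_closure (hD : ∀ v, ¬ D.Adj v v) {α β : unitInterval → Space D}
    (hα : Continuous α) (hβ : Continuous β) {S : Set unitInterval} (h : ∀ s ∈ S, α s = β s)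
    {t : unitInterval} (ht : t ∈ closure S) {x y : Node D} (hx : α t = .node x)
    (hy : β t = .node y) : x = y := by
  by_contra hne
  obtain ⟨U, W, hU, hW, hxU, hyW, hd⟩ := exists_disjoint_nhds_nodes hD hne
  obtain ⟨s, ⟨hsU, hsW⟩, hs⟩ := mem_closure_iff.1 ht _ ((hU.preimage hα).inter (hW.preimage hβ))
    ⟨by rwa [Set.mem_preimage, hx], by rwa [Set.mem_preimage, hy]⟩
  rw [Set.mem_preimage, h s hs] at hsU
  exact Set.disjoint_left.1 hd hsU hsW

/-- A directed topological path that runs between two nodes through inner points of a single edge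
traverses this edge from its tail to its head. -/
theorem IsDirectedTopPath.traverses (hD : ∀ v, ¬ D.Adj v v) {α : C(unitInterval, Space D)}
    (hα : IsDirectedTopPath α) {t u : unitInterval} (htu : t < u) {x y : Node D}
    (ht : α t = .node x) (hu : α u = .node y) {e : Edge D}
    (h : ∀ s ∈ Set.Ioo t u, α s ∈ openEdge e) :
    e.tail = x ∧ e.head = y ∧ Traverses α e := by
  obtain ⟨σ, hσ, hσt, hσu, hinj, hsurj, hασ⟩ := hα.exists_param htu ht hu h
  have hc : Continuous fun s => edgePt e (σ s) := (continuous_edgePt e).comp hσ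
  have hcl : closure (Set.Ioo t u) = Set.Icc t u := closure_Ioo htu.ne
  have hx : x = e.tail := eq_node_of_mem_closure hD α.continuous hc hασ
    (hcl ▸ ⟨le_rfl, htu.le⟩) ht (by rw [hσt, edgePt_zero])
  have hy : y = e.head := eq_node_of_mem_closure hD α.continuous hc hασ
    (hcl ▸ ⟨htu.le, le_rfl⟩) hu (by rw [hσu, edgePt_one])
  have heq : ∀ s ∈ Set.Icc t u, α s = edgePt e (σ s) := by
    intro s hs
    rcases hs.1.eq_or_lt with rfl | h1
    · rw [ht, hσt, edgePt_zero, hx]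
    · rcases hs.2.eq_or_lt with rfl | h2
      · rw [hu, hσu, edgePt_one, hy]
      · exact hασ s ⟨h1, h2⟩
  refine ⟨hx.symm, hy.symm, t, u, htu.le, ?_⟩
  have hemb : IsEmbedding fun s : Set.Icc t u => α s := by
    refine isEmbedding_of_mem_closedEdge hD (e := e) (α.continuous.comp continuous_subtype_val)
      (fun s s' hss => ?_) fun s => ⟨σ s, (heq s s.2).symm⟩
    simp only [heq s s.2, heq s' s'.2] at hss
    exact Subtype.ext (hinj s.2 s'.2 (edgePt_injective (e.tail_ne_head hD) hss))
  have hrange : Set.range (fun s : Set.Icc t u => α s) = closedEdge e := by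
    ext p
    constructor
    · rintro ⟨s, rfl⟩
      exact ⟨σ s, (heq s s.2).symm⟩
    · rintro ⟨z, rfl⟩
      obtain ⟨s, hs, rfl⟩ := hsurj (Set.mem_univ z)
      exact ⟨⟨s, hs⟩, heq s hs⟩
  exact ⟨hemb.toHomeomorph.trans (Homeomorph.setCongr hrange), fun s => rfl⟩

theorem exists_traverses_of_disjoint_closure (hD : ∀ v, ¬ D.Adj v v) {V₁ V₂ : Set V}
    (hV : IsCompl V₁ V₂) (hcl : closure (vertexSet D V₁) ∩ closure (vertexSet D V₂) = ∅)
    (α : C(unitInterval, Space D)) (hα : IsDirectedTopPath α) (h0 : α 0 ∈ vertexSet D V₁)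
    (h1 : α 1 ∈ vertexSet D V₂) :
    ∃ e : Edge D, Traverses α e ∧
      EdgeFromTo (closure (vertexSet D V₁)) (closure (vertexSet D V₂)) e := by
  have hc : ∀ A, IsClosed (α ⁻¹' closure (vertexSet D A)) := fun A =>
    isClosed_closure.preimage α.continuous
  have hnode : ∀ (A : Set V) p, p ∈ closure (vertexSet D A) → ∃ x, p = .node x := by
    intro A p hp
    cases p with
    | node x => exact ⟨x, rfl⟩
    | inner e t => exact (inner_notMem_closure hD e t A hp).elim
  obtain ⟨t, ht, htmax⟩ := (hc V₁).isCompact.exists_isGreatest ⟨0, subset_closure h0⟩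
  obtain ⟨u, ⟨hu, htu⟩, humin⟩ := ((hc V₂).inter isClosed_Ici).isCompact.exists_isLeast
    ⟨1, subset_closure h1, unitInterval.le_one' (t := t)⟩
  have htu : t < u := by
    refine lt_of_le_of_ne htu ?_
    rintro rfl
    exact (Set.eq_empty_iff_forall_notMem.1 hcl) _ ⟨ht, hu⟩
  obtain ⟨e, he⟩ := hα.1.exists_edge htu fun s hs => by
    rcases hαs : α s with x | ⟨e, z⟩
    · rcases node_mem_closure_or hV x with h | h
      · exact (not_lt.2 (htmax (show α s ∈ _ from hαs ▸ h)) hs.1).elim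
      · exact (not_lt.2 (humin ⟨show α s ∈ _ from hαs ▸ h, hs.1.le⟩) hs.2).elim
    · exact ⟨e, z, rfl⟩
  obtain ⟨x, hx⟩ := hnode _ _ ht
  obtain ⟨y, hy⟩ := hnode _ _ hu
  obtain ⟨rfl, rfl, htr⟩ := hα.traverses hD htu hx hy he
  exact ⟨e, htr, hx ▸ ht, hy ▸ hu⟩

end Jump

section Construction

open Topology

/-! ### A parametrization of the line -/

/-- The bijection `t ↦ 1 / (1 - 2 t)` of `ℝ`. It maps `[0, 1/2)` to `[1, ∞)` and `(1/2, 1]` to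
`(-∞, -1]`, and is increasing on both sides of `1/2`. -/
noncomputable def lineParam : ℝ ≃ ℝ where
  toFun t := (1 - 2 * t)⁻¹
  invFun s := (1 - s⁻¹) / 2
  left_inv t := by simp
  right_inv s := by
    have : 1 - 2 * ((1 - s⁻¹) / 2) = s⁻¹ := by ring
    simp [this]

theorem lineParam_apply (t : ℝ) : lineParam t = (1 - 2 * t)⁻¹ := rfl

theorem lineParam_symm_apply (s : ℝ) : lineParam.symm s = (1 - s⁻¹) / 2 := rfl

theorem lineParam_eq_zero {t : ℝ} : lineParam t = 0 ↔ t = 1 / 2 := by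
  rw [lineParam_apply, inv_eq_zero]
  constructor <;> intro h <;> linarith

theorem lineParam_lt {x y : ℝ} (hxy : x < y) (h : y < 1 / 2 ∨ 1 / 2 < x) :
    lineParam x < lineParam y := by
  rw [lineParam_apply, lineParam_apply]
  rcases h with h | h
  · exact inv_strictAnti₀ (by linarith) (by linarith)
  · rw [inv_lt_inv_of_neg] <;> linarith

theorem lineParam_symm_lt {x y : ℝ} (hxy : x < y) (h : y < 0 ∨ 0 < x) :
    lineParam.symm x < lineParam.symm y := by
  rw [lineParam_symm_apply, lineParam_symm_apply]
  have : y⁻¹ < x⁻¹ := by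
    rcases h with h | h
    · exact (inv_lt_inv_of_neg h (hxy.trans h)).2 hxy
    · exact inv_strictAnti₀ h hxy
  linarith

theorem one_le_abs_lineParam {t : ℝ} (ht : t ∈ Set.Icc (0 : ℝ) 1) (h : t ≠ 1 / 2) :
    1 ≤ lineParam t ∨ lineParam t ≤ -1 := by
  rw [lineParam_apply]
  rcases h.lt_or_gt with h | h
  · exact .inl ((one_le_inv₀ (by linarith)).2 (by linarith [ht.1]))
  · right
    have : 1 ≤ (-(1 - 2 * t))⁻¹ := (one_le_inv₀ (by linarith)).2 (by linarith [ht.2])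
    rw [inv_neg] at this
    linarith

theorem lineParam_symm_mem {s : ℝ} (h : 1 ≤ s ∨ s ≤ -1) :
    lineParam.symm s ∈ Set.Icc (0 : ℝ) 1 := by
  rw [lineParam_symm_apply]
  have : |s⁻¹| ≤ 1 := by
    rw [abs_inv]
    refine inv_le_one_of_one_le₀ ?_
    rcases h with h | h
    · exact h.trans (le_abs_self s)
    · exact (by linarith : 1 ≤ -s).trans (neg_le_abs s)
  rw [abs_le] at this
  constructor <;> linarith [this.1, this.2]

theorem lineParam_symm_pos {s : ℝ} : lineParam.symm s < 1 / 2 ↔ 0 < s := by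
  rw [lineParam_symm_apply, ← inv_pos]
  constructor <;> intro h <;> linarith

theorem lineParam_symm_neg {s : ℝ} : 1 / 2 < lineParam.symm s ↔ s < 0 := by
  rw [lineParam_symm_apply, ← inv_neg'']
  constructor <;> intro h <;> linarith

theorem continuousAt_lineParam {t : ℝ} (h : t ≠ 1 / 2) : ContinuousAt lineParam t := by
  change ContinuousAt (fun t : ℝ => (1 - 2 * t)⁻¹) t
  refine ContinuousAt.inv₀ (by fun_prop) fun h' => h (by linarith)

/-- The real numbers with non-integral parameter are dense. -/
theorem exists_between_not_int {x y : ℝ} (h : x < y) :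
    ∃ p ∈ Set.Ioo x y, p ≠ 1 / 2 ∧ ∀ n : ℤ, lineParam p ≠ n := by
  have hS : (Set.range fun n : ℤ => lineParam.symm n).Countable := Set.countable_range _
  obtain ⟨p, hp, hxp, hpy⟩ := (hS.dense_compl ℝ).exists_between h
  have hn : ∀ n : ℤ, lineParam p ≠ n := fun n hn =>
    hp ⟨n, by simp [← hn]⟩
  refine ⟨p, ⟨hxp, hpy⟩, fun h => hn 0 ?_, hn⟩
  rw [lineParam_eq_zero.2 h, Int.cast_zero]

/-! ### Bi-infinite walks -/

variable {V : Type u} {D : Digraph V}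

/-- The parametrization by `ℝ` of a bi-infinite sequence of edges. -/
noncomputable def walkPt (E : ℤ → Edge D) (s : ℝ) : Space D :=
  edgePt (E ⌊s⌋) (Set.projIcc 0 1 zero_le_one (s - ⌊s⌋))

variable {E : ℤ → Edge D}

theorem walkPt_eq (hE : ∀ n, n ≠ -1 → (E n).head = (E (n + 1)).tail) {s : ℝ} (hs : s ≠ 0) {n : ℤ}
    (h : s ∈ Set.Icc (n : ℝ) (n + 1)) :
    walkPt E s = edgePt (E n) (Set.projIcc 0 1 zero_le_one (s - n)) := by
  rcases h.2.eq_or_lt with h' | h'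
  · have hf : ⌊s⌋ = n + 1 := by
      rw [h']
      exact_mod_cast Int.floor_intCast (n + 1)
    have hn : n ≠ -1 := by
      rintro rfl
      exact hs (by simpa using h')
    rw [walkPt, hf, h', Set.projIcc_of_le_left _ (by push_cast; linarith),
      Set.projIcc_of_right_le _ (by linarith)]
    exact (edgePt_zero _).trans ((congrArg _ (hE n hn).symm).trans (edgePt_one _).symm)
  · rw [walkPt, Int.floor_eq_iff.2 ⟨h.1, h'⟩]

theorem continuous_edgePt_projIcc (e : Edge D) (c : ℝ) :
    Continuous fun s : ℝ => edgePt e (Set.projIcc 0 1 zero_le_one (s - c)) :=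
  (continuous_edgePt e).comp (continuous_projIcc.comp (continuous_id.sub continuous_const))

theorem continuousAt_walkPt (hE : ∀ n, n ≠ -1 → (E n).head = (E (n + 1)).tail) {s : ℝ}
    (hs : s ≠ 0) : ContinuousAt (walkPt E) s := by
  have h0 : ∀ᶠ r in 𝓝 s, r ≠ 0 := isOpen_ne.mem_nhds hs
  rw [continuousAt_iff_continuous_left_right]
  constructor
  · have hl : ((⌈s⌉ - 1 : ℤ) : ℝ) < s := by
      push_cast
      linarith [Int.ceil_lt_add_one s]
    have hr : s ≤ ((⌈s⌉ - 1 : ℤ) : ℝ) + 1 := by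
      push_cast
      linarith [Int.le_ceil s]
    refine (continuous_edgePt_projIcc (E (⌈s⌉ - 1)) (⌈s⌉ - 1 : ℤ)).continuousWithinAt
      |>.congr_of_eventuallyEq ?_ (walkPt_eq hE hs ⟨hl.le, hr⟩)
    filter_upwards [nhdsWithin_le_nhds h0, self_mem_nhdsWithin,
      nhdsWithin_le_nhds (lt_mem_nhds hl)] with r hr0 hrs hlr
    exact walkPt_eq hE hr0 ⟨hlr.le, le_trans hrs hr⟩
  · refine (continuous_edgePt_projIcc (E ⌊s⌋) ⌊s⌋).continuousWithinAt
      |>.congr_of_eventuallyEq ?_ (walkPt_eq hE hs ⟨Int.floor_le s, (Int.lt_floor_add_one s).le⟩)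
    filter_upwards [nhdsWithin_le_nhds h0, self_mem_nhdsWithin,
      nhdsWithin_le_nhds (gt_mem_nhds (Int.lt_floor_add_one s))] with r hr0 hrs hlr
    exact walkPt_eq hE hr0 ⟨le_trans (Int.floor_le s) hrs, hlr.le⟩

theorem walkPt_of_not_int {s : ℝ} (hs : ∀ n : ℤ, s ≠ n) : walkPt E s ∈ openEdge (E ⌊s⌋) := by
  have h1 : 0 < s - ⌊s⌋ := sub_pos.2 (lt_of_le_of_ne (Int.floor_le s) (hs _).symm)
  have h2 : s - ⌊s⌋ < 1 := by linarith [Int.lt_floor_add_one s]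
  rw [walkPt, Set.projIcc_of_mem _ ⟨h1.le, h2.le⟩, edgePt_of_mem_Ioo _ ⟨h1, h2⟩]
  exact ⟨_, rfl⟩

theorem walkPt_mem_openEdge {s : ℝ} {e : Edge D} (h : walkPt E s ∈ openEdge e) :
    (∀ n : ℤ, s ≠ n) ∧ E ⌊s⌋ = e := by
  refine ⟨?_, ?_⟩
  · rintro n rfl
    obtain ⟨z, hz⟩ := h
    rw [walkPt, Int.floor_intCast, sub_self, Set.projIcc_left] at hz
    exact absurd (hz.trans (edgePt_zero _)) (by simp)
  · obtain ⟨z, hz⟩ := h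
    exact (eq_of_inner_mem_closedEdge (hz ▸ ⟨_, rfl⟩ : Space.inner e z ∈ closedEdge _)).symm

/-- An interval that avoids `0` and is mapped to a single edge lies between two consecutive
integers. -/
theorem exists_int_of_edge_eq (hD : ∀ v, ¬ D.Adj v v)
    (hE : ∀ n, n ≠ -1 → (E n).head = (E (n + 1)).tail) {A B : ℝ} (hAB : A < B)
    (h0 : B < 0 ∨ 0 < A) {e : Edge D}
    (h : ∀ r ∈ Set.Ioo A B, (∀ n : ℤ, r ≠ n) → E ⌊r⌋ = e) :
    ∃ n : ℤ, E n = e ∧ (n : ℝ) ≤ A ∧ B ≤ n + 1 := by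
  have key : ∀ (n : ℤ) (a b : ℝ), a < b → (n : ℝ) ≤ a → b ≤ n + 1 → A ≤ a → b ≤ B → E n = e := by
    intro n a b hab hn hn' ha hb
    obtain ⟨r, hr, hr'⟩ := exists_between hab
    have hf : ⌊r⌋ = n := Int.floor_eq_iff.2 ⟨hn.trans hr.le, lt_of_lt_of_le hr' hn'⟩
    rw [← hf]
    refine h r ⟨lt_of_le_of_lt ha hr, lt_of_lt_of_le hr' hb⟩ fun m hm => ?_
    have : m = n := by rw [← hf, hm, Int.floor_intCast]
    rw [hm, this] at hr
    exact (not_lt.2 hn) hr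
  have hA := Int.floor_le A
  have hA' := Int.lt_floor_add_one A
  have h1 : E ⌊A⌋ = e := key _ A (min B (⌊A⌋ + 1)) (lt_min hAB hA') hA (min_le_right _ _) le_rfl
    (min_le_left _ _)
  refine ⟨⌊A⌋, h1, hA, ?_⟩
  by_contra! hB
  have h2 : E (⌊A⌋ + 1) = e := key _ (⌊A⌋ + 1) (min B (⌊A⌋ + 1 + 1)) (lt_min hB (by linarith))
    (by push_cast; rfl) (by push_cast; exact min_le_right _ _) hA'.le (min_le_left _ _)
  have hne : ⌊A⌋ ≠ -1 := by
    intro h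
    rw [h] at hA' hB
    push_cast at hA' hB
    rcases h0 with h0 | h0 <;> linarith
  have := hE _ hne
  rw [h1, h2] at this
  exact e.tail_ne_head hD this.symm

/-- The path that follows the edges of a bi-infinite walk, with the end `ω` at `1 / 2`. -/
noncomputable def limitPath (E : ℤ → Edge D) (ω : DEnd D) (t : unitInterval) : Space D :=
  open Classical in if (t : ℝ) = 1 / 2 then .node (.lim ω) else walkPt E (lineParam t)

variable {ω : DEnd D}

theorem limitPath_half {t : unitInterval} (h : (t : ℝ) = 1 / 2) :
    limitPath E ω t = .node (.lim ω) := if_pos h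

theorem limitPath_of_ne {t : unitInterval} (h : (t : ℝ) ≠ 1 / 2) :
    limitPath E ω t = walkPt E (lineParam t) := if_neg h

theorem continuous_limitPath (hE : ∀ n, n ≠ -1 → (E n).head = (E (n + 1)).tail)
    (hω : ∀ X : Finset V, ∃ N : ℕ, ∀ n : ℤ, (N : ℤ) ≤ |n| →
      InComp D X (endComp D X ω) (E n).tail ∧ InComp D X (endComp D X ω) (E n).head) :
    Continuous (limitPath E ω) := by
  refine continuous_iff_continuousAt.2 fun t => ?_
  by_cases ht : (t : ℝ) = 1 / 2
  · rw [ContinuousAt, limitPath_half ht]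
    refine TopologicalSpace.tendsto_nhds_generateFrom_iff.2 fun U hU hU' => ?_
    obtain ⟨X, ε, rfl⟩ := IsBasicOpen.eq_endNhd hU hU'
    obtain ⟨N, hN⟩ := hω X
    have hpt : ∀ n : ℤ, (N : ℤ) ≤ |n| → ∀ s, edgePt (E n) s ∈ endNhd D X ω ε := by
      intro n hn s
      rcases unitInterval_cases s with rfl | rfl | hs
      · rw [edgePt_zero]
        exact (hN n hn).1
      · rw [edgePt_one]
        exact (hN n hn).2
      · rw [edgePt_of_mem_Ioo _ hs]
        exact .inl (hN n hn)
    have hev : ∀ᶠ s : unitInterval in 𝓝 t, |1 - 2 * (s : ℝ)| < ((N : ℝ) + 1)⁻¹ := by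
      have hc : Continuous fun s : unitInterval => |1 - 2 * (s : ℝ)| := by fun_prop
      refine hc.continuousAt.eventually (gt_mem_nhds ?_)
      simp only [ht]
      norm_num
      positivity
    filter_upwards [hev] with s hs
    by_cases hs' : (s : ℝ) = 1 / 2
    · rw [Set.mem_preimage, limitPath_half hs']
      exact hU'
    · rw [Set.mem_preimage, limitPath_of_ne hs', walkPt]
      refine hpt _ ?_ _
      have hpos : 0 < |1 - 2 * (s : ℝ)| := abs_pos.2 fun h => hs' (by linarith)
      have hlt : (N : ℝ) + 1 < |lineParam s| := by
        rw [lineParam_apply, abs_inv]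
        exact (lt_inv_comm₀ hpos (by positivity)).1 hs
      have hf1 := Int.floor_le (lineParam s)
      have hf2 := Int.lt_floor_add_one (lineParam s)
      have : (N : ℝ) ≤ |(⌊lineParam s⌋ : ℝ)| := by
        rcases lt_abs.1 hlt with h | h
        · exact le_trans (by linarith) (le_abs_self _)
        · exact le_trans (by linarith) (neg_le_abs _)
      exact_mod_cast this
  · have h1 : ContinuousAt (fun s : unitInterval => walkPt E (lineParam s)) t :=
      ContinuousAt.comp (g := walkPt E) (f := fun s : unitInterval => lineParam s)
        (continuousAt_walkPt hE fun h => ht (lineParam_eq_zero.1 h))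
        (ContinuousAt.comp (g := lineParam) (continuousAt_lineParam ht)
          continuous_subtype_val.continuousAt)
    refine h1.congr ?_
    have : ∀ᶠ s : unitInterval in 𝓝 t, (s : ℝ) ≠ 1 / 2 :=
      continuous_subtype_val.continuousAt.eventually (isOpen_ne.mem_nhds ht)
    filter_upwards [this] with s hs
    rw [limitPath_of_ne hs]

theorem limitPath_mem_openEdge {t : unitInterval} {e : Edge D}
    (h : limitPath E ω t ∈ openEdge e) :
    (t : ℝ) ≠ 1 / 2 ∧ (∀ n : ℤ, lineParam t ≠ n) ∧ E ⌊lineParam t⌋ = e := by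
  have ht : (t : ℝ) ≠ 1 / 2 := by
    intro ht
    rw [limitPath_half ht] at h
    obtain ⟨z, hz⟩ := h
    cases hz
  rw [limitPath_of_ne ht] at h
  exact ⟨ht, walkPt_mem_openEdge h⟩

theorem eq_of_limitPath_mem_closedEdge {t : unitInterval} {e : Edge D} (ht : (t : ℝ) ≠ 1 / 2)
    (hn : ∀ n : ℤ, lineParam t ≠ n) (h : limitPath E ω t ∈ closedEdge e) :
    E ⌊lineParam t⌋ = e := by
  rw [limitPath_of_ne ht] at h
  obtain ⟨z, hz⟩ := walkPt_of_not_int (E := E) hn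
  rw [← hz] at h
  exact eq_of_inner_mem_closedEdge h

theorem isLocalHomeoOnEdges_limitPath (hD : ∀ v, ¬ D.Adj v v)
    (hE : ∀ n, n ≠ -1 → (E n).head = (E (n + 1)).tail) (hc : Continuous (limitPath E ω)) :
    IsLocalHomeoOnEdges ⟨limitPath E ω, hc⟩ := by
  intro e x hx hxe
  obtain ⟨hx2, hint, he⟩ := limitPath_mem_openEdge hxe
  set n := ⌊lineParam x⌋ with hn
  have hnx : (n : ℝ) < lineParam x := lt_of_le_of_ne (Int.floor_le _) (hint n).symm
  have hxn : lineParam x < n + 1 := Int.lt_floor_add_one _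
  have hside : 1 ≤ (n : ℝ) ∨ (n : ℝ) + 1 ≤ -1 := by
    rcases one_le_abs_lineParam x.2 hx2 with h | h
    · left
      have : (1 : ℤ) ≤ n := Int.le_floor.2 (by simpa using h)
      exact_mod_cast this
    · right
      have : n < -1 := by exact_mod_cast lt_of_lt_of_le hnx h
      exact_mod_cast (by omega : n + 1 ≤ -1)
  have hside0 : (n : ℝ) + 1 < 0 ∨ 0 < (n : ℝ) := by
    rcases hside with h | h
    · exact .inr (by linarith)
    · exact .inl (by linarith)
  let a : unitInterval := ⟨lineParam.symm n, lineParam_symm_mem (by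
    rcases hside with h | h
    · exact .inl h
    · exact .inr (by linarith))⟩
  let b : unitInterval := ⟨lineParam.symm (n + 1), lineParam_symm_mem (by
    rcases hside with h | h
    · exact .inl (by linarith)
    · exact .inr h)⟩
  have hab : (b : ℝ) < 1 / 2 ∨ 1 / 2 < (a : ℝ) := by
    rcases hside with h | h
    · exact .inl (lineParam_symm_pos.2 (by linarith))
    · exact .inr (lineParam_symm_neg.2 (by linarith))
  have hlt : ∀ r r', r < r' → (n : ℝ) ≤ r → r' ≤ n + 1 → lineParam.symm r < lineParam.symm r' :=
    fun r r' hr h h' => lineParam_symm_lt hr (hside0.imp (fun h => by linarith)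
      fun h => by linarith)
  have hxab : x ∈ Set.Ioo a b := by
    have h1 := hlt _ _ hnx le_rfl hxn.le
    have h2 := hlt _ _ hxn hnx.le le_rfl
    rw [Equiv.symm_apply_apply] at h1 h2
    exact ⟨h1, h2⟩
  have hne : ∀ t ∈ Set.Icc a b, (t : ℝ) ≠ 1 / 2 := by
    intro t ht h
    have h1 : (a : ℝ) ≤ t := ht.1
    have h2 : (t : ℝ) ≤ b := ht.2
    rcases hab with h' | h' <;> linarith
  have hmono : ∀ t ∈ Set.Icc a b, ∀ t' ∈ Set.Icc a b, t < t' → lineParam t < lineParam t' := by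
    intro t ht t' ht' htt
    have h1 : (a : ℝ) ≤ t := ht.1
    have h2 : (t' : ℝ) ≤ b := ht'.2
    exact lineParam_lt htt (hab.imp (fun h => by linarith) fun h => by linarith)
  have hale : a ≤ b := (hxab.1.trans hxab.2).le
  have ha : lineParam a = n := Equiv.apply_symm_apply _ _
  have hb : lineParam b = n + 1 := Equiv.apply_symm_apply _ _
  have hmem : ∀ t ∈ Set.Icc a b, lineParam t ∈ Set.Icc (n : ℝ) (n + 1) := by
    intro t ht
    constructor
    · rcases ht.1.eq_or_lt with rfl | h
      · exact ha.ge
      · exact ha ▸ (hmono a ⟨le_rfl, hale⟩ t ht h).le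
    · rcases ht.2.eq_or_lt with rfl | h
      · exact hb.le
      · exact hb ▸ (hmono t ht b ⟨hale, le_rfl⟩ h).le
  have heq : ∀ t ∈ Set.Icc a b, limitPath E ω t =
      edgePt e (Set.projIcc 0 1 zero_le_one (lineParam t - n)) := by
    intro t ht
    rw [limitPath_of_ne (hne t ht), walkPt_eq hE (fun h => hne t ht (lineParam_eq_zero.1 h))
      (hmem t ht), he]
  have hemb : IsEmbedding fun t : Set.Icc a b => limitPath E ω t := by
    refine isEmbedding_of_mem_closedEdge hD (e := e) (hc.comp continuous_subtype_val)
      (fun t t' htt => ?_) fun t => ⟨_, (heq t t.2).symm⟩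
    simp only [heq t t.2, heq t' t'.2] at htt
    have h1 := edgePt_injective (e.tail_ne_head hD) htt
    have hm : ∀ t : Set.Icc a b, lineParam (t : unitInterval) - n ∈ Set.Icc (0 : ℝ) 1 := fun t =>
      ⟨by linarith [(hmem t t.2).1], by linarith [(hmem t t.2).2]⟩
    have h2 := (Set.strictMonoOn_projIcc zero_le_one).injOn (hm t) (hm t') h1
    have h3 : lineParam (t : unitInterval) = lineParam (t' : unitInterval) := by linarith
    exact Subtype.ext (Subtype.ext (lineParam.injective h3))
  have hemb' : IsEmbedding fun t : Set.Ioo a b => limitPath E ω t :=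
    hemb.comp (IsEmbedding.inclusion Set.Ioo_subset_Icc_self)
  have hrange : Set.range (fun t : Set.Ioo a b => limitPath E ω t) = openEdge e := by
    ext p
    constructor
    · rintro ⟨t, rfl⟩
      have ht := Set.Ioo_subset_Icc_self t.2
      have h1 := hmono a ⟨le_rfl, hale⟩ t ht t.2.1
      have h2 := hmono t ht b ⟨hale, le_rfl⟩ t.2.2
      rw [ha] at h1
      rw [hb] at h2
      have hf : ⌊lineParam (t : unitInterval)⌋ = n := Int.floor_eq_iff.2 ⟨h1.le, h2⟩
      have := walkPt_of_not_int (E := E) (s := lineParam (t : unitInterval)) fun m hm => by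
        rw [hm, Int.floor_intCast] at hf
        rw [hm, hf] at h1
        exact lt_irrefl _ h1
      rw [hf, he] at this
      simpa only [limitPath_of_ne (hne t ht)] using this
    · rintro ⟨z, rfl⟩
      have hz1 := hlt n (n + z) (by linarith [z.2.1]) le_rfl (by linarith [z.2.2])
      have hz2 := hlt (n + z) (n + 1) (by linarith [z.2.2]) (by linarith [z.2.1]) le_rfl
      have hz : lineParam.symm (n + z) ∈ Set.Icc (0 : ℝ) 1 :=
        ⟨a.2.1.trans hz1.le, hz2.le.trans b.2.2⟩
      refine ⟨⟨⟨lineParam.symm (n + z), hz⟩, hz1, hz2⟩, ?_⟩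
      simp only
      rw [heq _ ⟨hz1.le, hz2.le⟩, ← edgePt_coe e z]
      simp only [Equiv.apply_symm_apply, add_sub_cancel_left]
      rw [Set.projIcc_of_mem _ ⟨z.2.1.le, z.2.2.le⟩]
  exact ⟨a, b, hxab, hemb'.toHomeomorph.trans (Homeomorph.setCongr hrange), fun t => rfl⟩

theorem respectsOrientation_limitPath (hD : ∀ v, ¬ D.Adj v v)
    (hE : ∀ n, n ≠ -1 → (E n).head = (E (n + 1)).tail)
    (hωE : ∀ n, Space.node (.lim ω) ∉ closedEdge (E n)) (hc : Continuous (limitPath E ω)) :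
    RespectsOrientation ⟨limitPath E ω, hc⟩ := by
  intro e a b hab x hx y hy hxy s t hs ht
  have hinj := edgePt_injective (e.tail_ne_head hD)
  rcases hxy.eq_or_lt with rfl | hlt
  · exact (hinj (hs.symm.trans ht)).le
  have hmaps : ∀ p ∈ Set.Icc x y, limitPath E ω p ∈ closedEdge e := fun p hp =>
    hab ⟨hx.1.trans hp.1, hp.2.trans hy.2⟩
  have hlt' : (x : ℝ) < y := hlt
  have hin : ∀ p : ℝ, p ∈ Set.Ioo (x : ℝ) y → p ≠ 1 / 2 → (∀ n : ℤ, lineParam p ≠ n) →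
      E ⌊lineParam p⌋ = e := by
    intro p hp hp2 hn
    have hp01 : p ∈ Set.Icc (0 : ℝ) 1 := ⟨x.2.1.trans hp.1.le, hp.2.le.trans y.2.2⟩
    exact eq_of_limitPath_mem_closedEdge (t := ⟨p, hp01⟩) hp2 hn
      (hmaps ⟨p, hp01⟩ ⟨hp.1.le, hp.2.le⟩)
  obtain ⟨p, hp, hp2, hpn⟩ := exists_between_not_int hlt'
  have hep := hin p hp hp2 hpn
  have hhalf : (y : ℝ) < 1 / 2 ∨ 1 / 2 < (x : ℝ) := by
    by_contra! h
    let m : unitInterval := ⟨1 / 2, by norm_num, by norm_num⟩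
    have hm := hmaps m ⟨h.2, h.1⟩
    rw [limitPath_half rfl, ← hep] at hm
    exact hωE _ hm
  have hx2 : (x : ℝ) ≠ 1 / 2 := by
    intro h
    rcases hhalf with h' | h' <;> linarith
  have hy2 : (y : ℝ) ≠ 1 / 2 := by
    intro h
    rcases hhalf with h' | h' <;> linarith
  have hAB := lineParam_lt hlt' hhalf
  have hsign : lineParam y < 0 ∨ 0 < lineParam x := by
    rcases hhalf with h | h
    · right
      rw [lineParam_apply, inv_pos]
      linarith
    · left
      rw [lineParam_apply, inv_lt_zero]
      linarith
  obtain ⟨n, rfl, hn1, hn2⟩ := exists_int_of_edge_eq hD hE hAB hsign fun r hr hrn => by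
    have h1 : lineParam.symm r ∈ Set.Ioo (x : ℝ) y := by
      constructor
      · have := lineParam_symm_lt hr.1 (hsign.imp_left hr.2.trans)
        rwa [Equiv.symm_apply_apply] at this
      · have := lineParam_symm_lt hr.2 (hsign.imp_right fun h => h.trans hr.1)
        rwa [Equiv.symm_apply_apply] at this
    have h2 := hin (lineParam.symm r) h1 (fun h => by
      rcases hhalf with h' | h'
      · linarith [h1.2]
      · linarith [h1.1]) (by simpa using hrn)
    rwa [Equiv.apply_symm_apply] at h2
  change limitPath E ω x = _ at hs
  change limitPath E ω y = _ at ht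
  rw [limitPath_of_ne hx2, walkPt_eq hE (fun h => hx2 (lineParam_eq_zero.1 h))
    ⟨hn1, hAB.le.trans hn2⟩] at hs
  rw [limitPath_of_ne hy2, walkPt_eq hE (fun h => hy2 (lineParam_eq_zero.1 h))
    ⟨hn1.trans hAB.le, hn2⟩] at ht
  rw [← hinj hs, ← hinj ht]
  exact Set.monotone_projIcc _ (by linarith)

theorem Traverses.exists_eq_edge {hc : Continuous (limitPath E ω)} {e : Edge D}
    (h : Traverses ⟨limitPath E ω, hc⟩ e) : ∃ n, E n = e := by
  obtain ⟨a, b, -, H, hH⟩ := h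
  let z : Set.Ioo (0 : ℝ) 1 := ⟨1 / 2, by norm_num, by norm_num⟩
  obtain ⟨t, ht⟩ := H.surjective ⟨.inner e z, _, edgePt_coe e z⟩
  have h1 := hH t
  rw [ht] at h1
  exact ⟨_, (limitPath_mem_openEdge (E := E) (ω := ω) (t := t) ⟨z, h1⟩).2.2⟩

/-- Two infinite walks, one directed towards and one directed away from the same end `ω`, form a
directed topological path through `ω`. -/
theorem exists_path_through_end (hD : ∀ v, ¬ D.Adj v v) (ω : DEnd D) {A B : Set V} {w w' : ℕ → V}
    (hwA : ∀ n, w n ∈ A) (hw : ∀ n, D.Adj (w n) (w (n + 1)))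
    (hwω : ∀ X, ∃ N, ∀ n, N ≤ n → w n ∈ endComp D X ω)
    (hwB : ∀ n, w' n ∈ B) (hw' : ∀ n, D.Adj (w' (n + 1)) (w' n))
    (hwω' : ∀ X, ∃ N, ∀ n, N ≤ n → w' n ∈ endComp D X ω) :
    ∃ α : C(unitInterval, Space D), IsDirectedTopPath α ∧ α 0 ∈ vertexSet D A ∧
      α 1 ∈ vertexSet D B ∧ ∀ e, Traverses α e →
        (∃ a ∈ A, ∃ b ∈ A, e.tail = .vtx a ∧ e.head = .vtx b) ∨
        ∃ a ∈ B, ∃ b ∈ B, e.tail = .vtx a ∧ e.head = .vtx b := by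
  let E : ℤ → Edge D := fun n => match n with
    | .ofNat n => ⟨.vtx (w n), .vtx (w (n + 1)), hw n⟩
    | .negSucc n => ⟨.vtx (w' (n + 1)), .vtx (w' n), hw' n⟩
  have hE : ∀ n, n ≠ -1 → (E n).head = (E (n + 1)).tail := by
    intro n hn
    match n with
    | .ofNat n => rfl
    | .negSucc 0 => exact (hn rfl).elim
    | .negSucc (n + 1) => rfl
  have hEω : ∀ X : Finset V, ∃ N : ℕ, ∀ n : ℤ, (N : ℤ) ≤ |n| →
      InComp D X (endComp D X ω) (E n).tail ∧ InComp D X (endComp D X ω) (E n).head := by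
    intro X
    obtain ⟨N, hN⟩ := hwω X
    obtain ⟨M, hM⟩ := hwω' X
    refine ⟨max N M + 1, fun n hn => ?_⟩
    match n with
    | .ofNat n =>
      have : max N M + 1 ≤ n := by simpa using hn
      exact ⟨hN n (by omega), hN (n + 1) (by omega)⟩
    | .negSucc n =>
      have : max N M + 1 ≤ n + 1 := by
        rw [Int.negSucc_eq] at hn
        rcases le_abs.1 hn with h | h <;> omega
      exact ⟨hM (n + 1) (by omega), hM n (by omega)⟩
  have hωE : ∀ n, Space.node (.lim ω) ∉ closedEdge (E n) := by
    rintro n ⟨s, hs⟩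
    rcases unitInterval_cases s with rfl | rfl | hs'
    · rw [edgePt_zero] at hs
      cases n <;> cases hs
    · rw [edgePt_one] at hs
      cases n <;> cases hs
    · rw [edgePt_of_mem_Ioo _ hs'] at hs
      cases hs
  have hc := continuous_limitPath hE hEω
  have hint : ∀ n : ℤ, walkPt E n = .node (E n).tail := fun n => by
    rw [walkPt, Int.floor_intCast, sub_self, Set.projIcc_left]
    exact edgePt_zero _
  refine ⟨⟨limitPath E ω, hc⟩, ⟨isLocalHomeoOnEdges_limitPath hD hE hc,
    respectsOrientation_limitPath hD hE hωE hc⟩, ⟨w 1, hwA 1, ?_⟩, ⟨w' 1, hwB 1, ?_⟩, fun e he => ?_⟩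
  · have h1 : lineParam ((0 : unitInterval) : ℝ) = ((1 : ℤ) : ℝ) := by simp [lineParam_apply]
    change _ = limitPath E ω 0
    rw [limitPath_of_ne (by norm_num), h1, hint]
  · have h1 : lineParam ((1 : unitInterval) : ℝ) = ((-1 : ℤ) : ℝ) := by
      rw [lineParam_apply]
      norm_num
    change _ = limitPath E ω 1
    rw [limitPath_of_ne (by norm_num), h1, hint]
    rfl
  · obtain ⟨n, rfl⟩ := he.exists_eq_edge
    match n with
    | .ofNat n => exact .inl ⟨_, hwA n, _, hwA (n + 1), rfl, rfl⟩
    | .negSucc n => exact .inr ⟨_, hwB (n + 1), _, hwB n, rfl, rfl⟩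

theorem exists_path_of_closure_inter_nonempty (hD : ∀ v, ¬ D.Adj v v) {V₁ V₂ : Set V}
    (hV : IsCompl V₁ V₂)
    (hcl : (closure (vertexSet D V₁) ∩ closure (vertexSet D V₂)).Nonempty)
    (h₁ : IsSolid (induce D V₁)) (h₂ : IsSolid (induce D V₂)) :
    ∃ α : C(unitInterval, Space D), IsDirectedTopPath α ∧
      α 0 ∈ vertexSet D V₁ ∧ α 1 ∈ vertexSet D V₂ ∧
      ∀ e : Edge D, Traverses α e →
        ¬ EdgeFromTo (closure (vertexSet D V₁)) (closure (vertexSet D V₂)) e ∧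
        ¬ EdgeFromTo (closure (vertexSet D V₂)) (closure (vertexSet D V₁)) e := by
  have hdisj : ∀ v, v ∈ V₁ → v ∈ V₂ → False := fun v h h' =>
    Set.disjoint_left.1 hV.disjoint h h'
  obtain ⟨p, hp₁, hp₂⟩ := hcl
  match p with
  | .inner e t => exact (inner_notMem_closure hD e t _ hp₁).elim
  | .node (.vtx v) =>
    exact (hdisj v (vtx_mem_closure_iff.1 hp₁) (vtx_mem_closure_iff.1 hp₂)).elim
  | .node (.lim ω) =>
    obtain ⟨⟨w, hwA, hw, hwω⟩, -⟩ :=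
      (isDirection_endComp ω).exists_walk_induce h₁ (endComp_inter_nonempty hp₁)
    obtain ⟨-, w', hwB, hw', hwω'⟩ :=
      (isDirection_endComp ω).exists_walk_induce h₂ (endComp_inter_nonempty hp₂)
    obtain ⟨α, hα, h0, h1, hα'⟩ := exists_path_through_end hD ω hwA hw hwω hwB hw' hwω'
    refine ⟨α, hα, h0, h1, fun e he => ?_⟩
    simp only [EdgeFromTo]
    obtain ⟨a, ha, b, hb, hta, hhb⟩ | ⟨a, ha, b, hb, hta, hhb⟩ := hα' e he <;>
      rw [hta, hhb] <;> simp only [vtx_mem_closure_iff]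
    · exact ⟨fun h => hdisj b hb h.2, fun h => hdisj a ha h.1⟩
    · exact ⟨fun h => hdisj a h.1 ha, fun h => hdisj b h.2 hb⟩

end Construction

end DTop

theorem mainTheorem7 {V : Type*} (D : Digraph V) (hD : ∀ v, ¬ D.Adj v v)
    (V₁ V₂ : Set V) (hV : IsCompl V₁ V₂) :
    (closure (DTop.vertexSet D V₁) ∩ closure (DTop.vertexSet D V₂) = ∅ →
      ∀ α : C(unitInterval, DTop.Space D), DTop.IsDirectedTopPath α →
        α 0 ∈ DTop.vertexSet D V₁ → α 1 ∈ DTop.vertexSet D V₂ →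
        ∃ e : DTop.Edge D, DTop.Traverses α e ∧
          DTop.EdgeFromTo (closure (DTop.vertexSet D V₁)) (closure (DTop.vertexSet D V₂)) e) ∧
    ((closure (DTop.vertexSet D V₁) ∩ closure (DTop.vertexSet D V₂)).Nonempty →
      DTop.IsSolid (DTop.induce D V₁) → DTop.IsSolid (DTop.induce D V₂) →
      ∃ α : C(unitInterval, DTop.Space D), DTop.IsDirectedTopPath α ∧
        α 0 ∈ DTop.vertexSet D V₁ ∧ α 1 ∈ DTop.vertexSet D V₂ ∧
        ∀ e : DTop.Edge D, DTop.Traverses α e →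
          ¬ DTop.EdgeFromTo (closure (DTop.vertexSet D V₁)) (closure (DTop.vertexSet D V₂)) e ∧
          ¬ DTop.EdgeFromTo (closure (DTop.vertexSet D V₂)) (closure (DTop.vertexSet D V₁)) e) :=
  ⟨fun hcl α hα h0 h1 => DTop.exists_traverses_of_disjoint_closure hD hV hcl α hα h0 h1,
    fun hcl h₁ h₂ => DTop.exists_path_of_closure_inter_nonempty hD hV hcl h₁ h₂⟩
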